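/- Let $N$ players have action sets $A_i\subseteq\mathbb R^d$ and cost functions $J_i:\mathbb R^{Nd}\to\mathbb R$, $i=1,\dots,N$; put $A=A_1\times\dots\times A_N$. Write $a=(a^1,\dots,a^N)\in\mathbb R^{Nd}$ with $a^i\in\mathbb R^d$, and $(z,a^{-i})$ for $a$ with $a^i$ replaced by $z$; norms and inner products are Euclidean. A Nash equilibrium is a point $a^*\in A$ with $J_i(a^*)\le J_i(z,a^{*,-i})$ for all $i$ and all $z\in A_i$. Assume: 1. every $A_i$ is closed and convex, every $J_i$ is continuously differentiable on $\mathbb R^{Nd}$, and $z\mapsto J_i(z,a^{-i})$ is convex on $\mathbb R^d$ for each fixed $a^{-i}$; 2. the game mapping $M=(M_1,\dots,M_N)$, $M_i(a)=\nabla_{a^i}J_i(a)$, is monotone on $A$: $(M(a)-M(a'),a-a')\ge 0$ for all $a,a'\in A$; 3. the variational inequality has a solution: there is $y\in A$ with $(M(y),z-y)\ge0$ for all $z\in A$; 4. each $M_i:\mathbb R^{Nd}\to\mathbb R^d$ is Lipschitz continuous; 5. the costs grow at most linearly: $|J_i(a)|=O(\|a\|)$ as $\|a\|\to\infty$, for every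 $i$; 6. for some $\alpha,b,c>0$ one has $\gamma(t)=t^{-\alpha}$, $\sigma(t)=t^{-b}$, $\varepsilon(t)=t^{-c}$ for all integers $t\ge1$, while $\gamma(0),\sigma(0),\varepsilon(0)>0$ are arbitrary, and with $\beta(t)=\gamma(t)\sigma^2(t)$: (a) $\sum_{t\ge 0}\beta(t)=\infty$ and $\varepsilon(t)\to0$; (b) $\sum_{t\ge1}\bigl(1+\tfrac1{\beta(t)\varepsilon(t)}\bigr)\tfrac{|\varepsilon(t-1)-\varepsilon(t)|^2}{\varepsilon(t)^2}<\infty$; (c) $\sum_{t\ge 0}\gamma(t)^2<\infty$ and $\sum_{t\ge 0}\beta(t)\sigma(t)<\infty$; (d) $\sigma(t)\to0$ and $\sum_{t\ge 0}\beta(t)\varepsilon(t)=\infty$. Let $\mu(0)\in\mathbb R^{Nd}$ be an arbitrary deterministic point. For $t=0,1,2,\dots$, conditionally on the past (the states $x(s)$, $s<t$, and the means $\mu(s)$, $s\le t$), let the coordinates $x^i_k(t)$ of the joint state $x(t)=(x^1(t),\dots,x^N(t))$ be independent normal random variables with means $\mu^i_k(t)$ and standard deviation $\sigma(t)$, and let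 $$\mu^i(t+1)=\mathrm{Proj}_{A_i}\Bigl[\mu^i(t)-\gamma(t)\sigma^2(t)\Bigl(J_i(x(t))\,\frac{x^i(t)-\mu^i(t)}{\sigma^2(t)}+\varepsilon(t)\mu^i(t)\Bigr)\Bigr],\qquad i=1,\dots,N,$$ where $\mathrm{Proj}_{A_i}$ is the Euclidean projection on $A_i$. Then there is a Nash equilibrium $a^*$ of the game, of least norm among all its Nash equilibria, such that $\mu(t)\to a^*$ almost surely and $x(t)\to a^*$ in probability as $t\to\infty$. -/

import Mathlib

open MeasureTheory ProbabilityTheory Filter Topology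

noncomputable section

namespace PayoffLearning

/-- The action space `ℝ^d` of one player, with the Euclidean norm. -/
abbrev Action (d : ℕ) : Type := EuclideanSpace ℝ (Fin d)

/-- Joint actions `(a^1, …, a^N)`, that is `ℝ^{Nd}` with the Euclidean norm. -/
abbrev Joint (N d : ℕ) : Type := PiLp 2 (fun _ : Fin N => Action d)

/-- The joint action `(z, a^{-i})`: the action of player `i` is replaced by `z`. -/
def Joint.replace {N d : ℕ} (a : Joint N d) (i : Fin N) (z : Action d) : Joint N d :=
  WithLp.toLp 2 (Function.update a.ofLp i z)

/-- A game with `N` players, action sets `A i ⊆ ℝ^d` and cost functions `J i` on `ℝ^{Nd}`. -/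
structure Game (N d : ℕ) where
  A : Fin N → Set (Action d)
  J : Fin N → Joint N d → ℝ

variable {N d : ℕ}

/-- The set `A_1 × … × A_N` of joint actions of the game. -/
def Game.jointSet (G : Game N d) : Set (Joint N d) :=
  {a | ∀ i, a i ∈ G.A i}

/-- The game is convex: closed convex action sets, and continuously differentiable costs that are
convex in the player's own action. -/
structure Game.IsConvex (G : Game N d) : Prop where
  convex_set : ∀ i, Convex ℝ (G.A i)
  closed_set : ∀ i, IsClosed (G.A i)
  contDiff_cost : ∀ i, ContDiff ℝ 1 (G.J i)
  convex_cost : ∀ i (a : Joint N d), ConvexOn ℝ Set.univ (fun z => G.J i (a.replace i z))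

/-- The game mapping `M(a) = (∇_{a^i} J_i(a^i, a^{-i}))_i`. -/
def Game.mapping (G : Game N d) (a : Joint N d) : Joint N d :=
  WithLp.toLp 2 (fun i => gradient (fun z => G.J i (a.replace i z)) (a i))

/-- Monotonicity of a mapping over a set. -/
def IsMonotoneOver (T : Joint N d → Joint N d) (Y : Set (Joint N d)) : Prop :=
  ∀ x ∈ Y, ∀ y ∈ Y, 0 ≤ inner ℝ (T x - T y) (x - y)

/-- The solution set `SOL(Y, T)` of the variational inequality `VI(Y, T)`. -/
def viSol (Y : Set (Joint N d)) (T : Joint N d → Joint N d) : Set (Joint N d) :=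
  {y | y ∈ Y ∧ ∀ z ∈ Y, 0 ≤ inner ℝ (T y) (z - y)}

/-- Nash equilibria of the game. -/
def Game.IsNash (G : Game N d) (a : Joint N d) : Prop :=
  a ∈ G.jointSet ∧ ∀ i, ∀ z ∈ G.A i, G.J i a ≤ G.J i (a.replace i z)

/-- Every component `M_i : ℝ^{Nd} → ℝ^d` of the game mapping is Lipschitz. -/
def Game.LipschitzMapping (G : Game N d) : Prop :=
  ∀ i, ∃ L : NNReal, LipschitzWith L (fun a => G.mapping a i)

/-- Every cost grows at most linearly: `J_i(a) = O(‖a‖)` as `‖a‖ → ∞`. -/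
def Game.LinearGrowth (G : Game N d) : Prop :=
  ∀ i, (G.J i) =O[Bornology.cobounded (Joint N d)] (fun a => ‖a‖)

/-- The parameters `γ(t) = t^{-a}`, `σ(t) = t^{-b}`, `ε(t) = t^{-c}` (for `t ≥ 1`, with arbitrary
positive values at `t = 0`), with the summability conditions in which `β(t) = γ(t) σ(t)²`.
The series over `ε(t-1) - ε(t)` starts at `t = 1`. -/
structure StepSizes (a b c : ℝ) (γ σ ε : ℕ → ℝ) : Prop where
  a_pos : 0 < a
  b_pos : 0 < b
  c_pos : 0 < c
  gamma_eq : ∀ t : ℕ, 1 ≤ t → γ t = 1 / (t : ℝ) ^ a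
  sigma_eq : ∀ t : ℕ, 1 ≤ t → σ t = 1 / (t : ℝ) ^ b
  eps_eq : ∀ t : ℕ, 1 ≤ t → ε t = 1 / (t : ℝ) ^ c
  gamma_zero : 0 < γ 0
  sigma_zero : 0 < σ 0
  eps_zero : 0 < ε 0
  beta_sum : ¬ Summable (fun t => γ t * σ t ^ 2)
  eps_lim : Tendsto ε atTop (𝓝 0)
  drift_sum : Summable (fun t =>
    (1 + 1 / (γ (t + 1) * σ (t + 1) ^ 2 * ε (t + 1))) * (|ε t - ε (t + 1)| ^ 2 / ε (t + 1) ^ 2))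
  gamma_sq_sum : Summable (fun t => γ t ^ 2)
  beta_sigma_sum : Summable (fun t => γ t * σ t ^ 2 * σ t)
  sigma_lim : Tendsto σ atTop (𝓝 0)
  beta_eps_sum : ¬ Summable (fun t => γ t * σ t ^ 2 * ε t)

/-- The law of a joint action whose coordinates `x^i_k` are independent normal variables with
means `m^i_k` and common standard deviation `s`. -/
def playLaw (m : Joint N d) (s : ℝ) : Measure (Joint N d) :=
  (Measure.pi fun i : Fin N =>
    (Measure.pi fun k : Fin d => gaussianReal (m i k) (Real.toNNReal (s ^ 2))).map
      (WithLp.toLp 2)).map (WithLp.toLp 2)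

/-- `p` is the Euclidean projection of `z` on `C`. -/
def IsProj (C : Set (Action d)) (z p : Action d) : Prop :=
  p ∈ C ∧ ∀ q ∈ C, ‖z - p‖ ≤ ‖z - q‖

/-- `(μ, x)` is a run of the regularized payoff-based algorithm with initial mean `m₀`.
The σ-algebra `ℱ t` contains the history before the actions `x t` are drawn; given `ℱ t`, the
joint action `x t` has the normal law with mean `μ t` and standard deviation `σ t`. -/
structure IsRun {Ω : Type*} [mΩ : MeasurableSpace Ω] (P : Measure Ω) (ℱ : Filtration ℕ mΩ)
    (G : Game N d) (γ σ ε : ℕ → ℝ) (m₀ : Joint N d) (μ x : ℕ → Ω → Joint N d) : Prop where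
  init : ∀ ω, μ 0 ω = m₀
  mean_meas : ∀ t, Measurable[ℱ t] (μ t)
  play_meas : ∀ t, Measurable[ℱ (t + 1)] (x t)
  play_law : ∀ t, ∀ B : Set (Joint N d), MeasurableSet B →
    P⟦x t ⁻¹' B | ℱ t⟧ =ᵐ[P] fun ω => (playLaw (μ t ω) (σ t)).real B
  update : ∀ t ω i, IsProj (G.A i)
    (μ t ω i - (γ t * σ t ^ 2) •
      ((G.J i (x t ω) / σ t ^ 2) • (x t ω i - μ t ω i) + ε t • μ t ω i))
    (μ (t + 1) ω i)

end PayoffLearning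

end

/-! ### Projections and Tikhonov regularization of monotone variational inequalities. -/

section VariationalInequality

variable {E : Type*} [NormedAddCommGroup E] [InnerProductSpace ℝ E]

/-! In a convex game the Nash equilibria are the solutions of the variational inequality for `M` on
`A` (`Game.IsConvex.isNash_iff`). Mere monotonicity gives no contraction towards them, so the means
are compared with Tikhonov points `y t`, which solve the inequality for `M + ε t • id`. These
converge to the solution of least norm (`exists_tendsto_tikhonov`), and one step of this path has
length at most `|ε t - ε (t+1)| / ε (t+1)` times a bound on its norms
(`regularized_vi_norm_sub_le`).

A payoff reveals the gradient as follows. Write `x = m + s z` with `z` standard Gaussian; block `i`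
of the estimate is then `J_i(x) z_i / s`. Resetting the own action in `J_i(x)` to `m_i` leaves a
function that does not depend on `z_i`; its product with `z_i` is odd in `z_i` and has mean zero.
What remains is the increment of `J_i` in the own action: its linear part has mean `M_i(m)` after
multiplication by `z_i / s`, because the covariance is the identity, and its remainder is of order
`s` (`Game.IsConvex.abs_integral_block_sub_le`). The second moment of the estimate is of order `(1 +
‖m‖²) / s²`, which after multiplication by `β² = γ² s⁴` leaves a term of order `γ²`.

Since `y t` is fixed by the exact projected step and projections do not expand distances, the mean
square distance to `y t` is contracted by `1 - 2βε`, up to errors of order `βσ + γ²`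
(`Game.exists_integral_step_sq_le`). Passing from `y t` to `y (t+1)` costs half of the contraction
and a summable drift. A Robbins–Siegmund argument (`ae_tendsto_zero_of_setIntegral_le`) with `∑ βε =
∞` then sends the distance to zero almost surely. Finally `x t - μ t` has size `σ t` in mean. -/

theorem inner_sub_le_zero_of_forall_norm_sub_le {K : Set E} (hK : Convex ℝ K) {z p : E}
    (hp : p ∈ K) (h : ∀ q ∈ K, ‖z - p‖ ≤ ‖z - q‖) {w : E} (hw : w ∈ K) :
    inner ℝ (z - p) (w - p) ≤ 0 := by
  refine (norm_eq_iInf_iff_real_inner_le_zero hK hp).1 ?_ w hw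
  have : Nonempty K := ⟨⟨p, hp⟩⟩
  refine le_antisymm (le_ciInf fun q => h q q.2) ?_
  exact ciInf_le (f := fun q : K => ‖z - q‖) ⟨0, by rintro _ ⟨q, rfl⟩; exact norm_nonneg _⟩ ⟨p, hp⟩

theorem exists_forall_inner_sub_le_zero [CompleteSpace E] {K : Set E} (hK : Convex ℝ K)
    (hc : IsClosed K) (hne : K.Nonempty) (z : E) :
    ∃ p ∈ K, ∀ w ∈ K, inner ℝ (z - p) (w - p) ≤ 0 := by
  obtain ⟨p, hp, h⟩ := exists_norm_eq_iInf_of_complete_convex hne hc.isComplete hK z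
  exact ⟨p, hp, (norm_eq_iInf_iff_real_inner_le_zero hK hp).1 h⟩

/-- Adding the two obtuse-angle inequalities and applying Cauchy–Schwarz shows that projections are
nonexpansive. Only the angle conditions at the two points are assumed, so no projection onto the
joint set has to be constructed when players project separately. -/
theorem norm_sub_le_of_inner_sub_le_zero {z z' p p' : E}
    (h : inner ℝ (z - p) (p' - p) ≤ 0) (h' : inner ℝ (z' - p') (p - p') ≤ 0) :
    ‖p - p'‖ ≤ ‖z - z'‖ := by
  have key : ‖p - p'‖ * ‖p - p'‖ ≤ inner ℝ (z - z') (p - p') := by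
    rw [← real_inner_self_eq_norm_mul_norm]
    have e1 : inner ℝ (z - p) (p' - p) = - inner ℝ (z - p) (p - p') := by
      rw [← inner_neg_right, neg_sub]
    have e2 : inner ℝ (z - z') (p - p') - inner ℝ (p - p') (p - p')
        = inner ℝ (z - p) (p - p') - inner ℝ (z' - p') (p - p') := by
      rw [← inner_sub_left, ← inner_sub_left]; congr 1; abel
    linarith
  have h2 := key.trans (real_inner_le_norm _ _)
  rcases (norm_nonneg (p - p')).eq_or_lt with h0 | h0
  · rw [← h0]; exact norm_nonneg _
  · exact le_of_mul_le_mul_right h2 h0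

/-- Solvability of the Tikhonov-regularized variational inequality. -/
theorem exists_regularized_vi [CompleteSpace E] {K : Set E} (hK : Convex ℝ K)
    (hc : IsClosed K) (hne : K.Nonempty) {T : E → E} {L : ℝ} (hL : 0 ≤ L)
    (hlip : ∀ u ∈ K, ∀ v ∈ K, ‖T u - T v‖ ≤ L * ‖u - v‖)
    (hmono : ∀ u ∈ K, ∀ v ∈ K, 0 ≤ inner ℝ (T u - T v) (u - v)) {ε : ℝ} (hε : 0 < ε) :
    ∃ y ∈ K, ∀ z ∈ K, 0 ≤ inner ℝ (T y + ε • y) (z - y) := by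
  choose pr hprK hpr using exists_forall_inner_sub_le_zero hK hc hne
  -- This step length minimizes `1 - 2τε + τ²(L + ε)²`, the squared contraction factor of the
  -- projected step; the minimum is `q` below.
  set τ : ℝ := ε / (L + ε) ^ 2 with hτ
  have hLε : 0 < L + ε := by linarith
  have hτ0 : 0 < τ := by positivity
  set S : E → E := fun u => T u + ε • u with hS
  have hSlip : ∀ u ∈ K, ∀ v ∈ K, ‖S u - S v‖ ≤ (L + ε) * ‖u - v‖ := by
    intro u hu v hv
    have : S u - S v = (T u - T v) + ε • (u - v) := by simp only [hS, smul_sub]; abel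
    rw [this]
    refine (norm_add_le _ _).trans ?_
    rw [norm_smul, Real.norm_of_nonneg hε.le]
    linarith [hlip u hu v hv]
  have hSmono : ∀ u ∈ K, ∀ v ∈ K, ε * ‖u - v‖ ^ 2 ≤ inner ℝ (u - v) (S u - S v) := by
    intro u hu v hv
    have : S u - S v = (T u - T v) + ε • (u - v) := by simp only [hS, smul_sub]; abel
    rw [this, inner_add_right, real_inner_smul_right, real_inner_self_eq_norm_sq,
      real_inner_comm]
    linarith [hmono u hu v hv]
  set q : ℝ := 1 - ε ^ 2 / (L + ε) ^ 2 with hq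
  have hq1 : q < 1 := by
    have : 0 < ε ^ 2 / (L + ε) ^ 2 := by positivity
    linarith
  have hq0 : 0 ≤ q := by
    have : ε ^ 2 / (L + ε) ^ 2 ≤ 1 := by
      rw [div_le_one (by positivity)]; gcongr; linarith
    linarith
  have hcontr : ∀ u ∈ K, ∀ v ∈ K, ‖pr (u - τ • S u) - pr (v - τ • S v)‖ ≤ √q * ‖u - v‖ := by
    intro u hu v hv
    refine (norm_sub_le_of_inner_sub_le_zero (hpr _ _ (hprK _)) (hpr _ _ (hprK _))).trans ?_
    rw [← Real.sqrt_sq (norm_nonneg (u - v)), ← Real.sqrt_mul hq0]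
    apply Real.le_sqrt_of_sq_le
    have e : (u - τ • S u) - (v - τ • S v) = (u - v) - τ • (S u - S v) := by
      rw [smul_sub]; abel
    rw [e, norm_sub_sq_real, real_inner_smul_right, norm_smul, Real.norm_of_nonneg hτ0.le, mul_pow]
    have h1 := hSmono u hu v hv
    have h2 : ‖S u - S v‖ ^ 2 ≤ ((L + ε) * ‖u - v‖) ^ 2 := by
      gcongr; exact hSlip u hu v hv
    calc ‖u - v‖ ^ 2 - 2 * (τ * inner ℝ (u - v) (S u - S v)) + τ ^ 2 * ‖S u - S v‖ ^ 2
        ≤ ‖u - v‖ ^ 2 - 2 * (τ * (ε * ‖u - v‖ ^ 2)) + τ ^ 2 * ((L + ε) * ‖u - v‖) ^ 2 := by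
          gcongr
      _ = q * ‖u - v‖ ^ 2 := by
          rw [hq, hτ]; field_simp; ring
  have : CompleteSpace K := hc.completeSpace_coe
  have : Nonempty K := hne.to_subtype
  let f : K → K := fun u => ⟨pr (u - τ • S u), hprK _⟩
  have hf : ContractingWith (√q).toNNReal f := by
    refine ⟨?_, LipschitzWith.of_dist_le_mul fun u v => ?_⟩
    · rw [Real.toNNReal_lt_one, Real.sqrt_lt' one_pos]; simpa using hq1
    · rw [Real.coe_toNNReal _ (Real.sqrt_nonneg _), Subtype.dist_eq, Subtype.dist_eq, dist_eq_norm,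
        dist_eq_norm]
      exact hcontr u u.2 v v.2
  set y : K := ContractingWith.fixedPoint f hf with hy
  have hfix : pr ((y : E) - τ • S y) = y := congrArg Subtype.val hf.fixedPoint_isFixedPt
  refine ⟨y, y.2, fun z hz => ?_⟩
  have h := hpr ((y : E) - τ • S y) z hz
  rw [hfix, sub_sub_cancel_left, inner_neg_left, real_inner_smul_left] at h
  have h3 : 0 ≤ τ * inner ℝ (S y) (z - y) := by linarith
  exact nonneg_of_mul_nonneg_right h3 hτ0

/-- Comparison of the solutions of two regularized variational inequalities. -/
theorem regularized_vi_compare {T : E → E} {u v : E} {ε δ : ℝ}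
    (hT : 0 ≤ inner ℝ (T u - T v) (u - v))
    (hu : 0 ≤ inner ℝ (T u + ε • u) (v - u)) (hv : 0 ≤ inner ℝ (T v + δ • v) (u - v)) :
    δ * inner ℝ v (v - u) ≤ ε * inner ℝ u (v - u) := by
  have e : u - v = -(v - u) := by abel
  rw [e] at hT hv
  rw [inner_neg_right] at hT hv
  rw [inner_sub_left] at hT
  rw [inner_add_left, real_inner_smul_left] at hu hv
  linarith

/-- Controls the drift of the Tikhonov path: strong monotonicity at level `ε` absorbs the mismatch
`(ε - δ) v` of the two regularizations. -/
theorem regularized_vi_norm_sub_le {T : E → E} {u v : E} {ε δ : ℝ} (hε : 0 < ε)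
    (hT : 0 ≤ inner ℝ (T u - T v) (u - v))
    (hu : 0 ≤ inner ℝ (T u + ε • u) (v - u)) (hv : 0 ≤ inner ℝ (T v + δ • v) (u - v)) :
    ‖v - u‖ ≤ |ε - δ| / ε * ‖v‖ := by
  have h := regularized_vi_compare hT hu hv
  have e : inner ℝ u (v - u) = inner ℝ v (v - u) - ‖v - u‖ * ‖v - u‖ := by
    rw [← real_inner_self_eq_norm_mul_norm, ← inner_sub_left, sub_sub_cancel]
  rw [e] at h
  have h1 : ε * (‖v - u‖ * ‖v - u‖) ≤ |ε - δ| * (‖v‖ * ‖v - u‖) := by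
    calc ε * (‖v - u‖ * ‖v - u‖) ≤ (ε - δ) * inner ℝ v (v - u) := by linarith
      _ ≤ |ε - δ| * |inner ℝ v (v - u)| := by rw [← abs_mul]; exact le_abs_self _
      _ ≤ _ := by gcongr; exact abs_real_inner_le_norm _ _
  rcases (norm_nonneg (v - u)).eq_or_lt with h0 | h0
  · rw [← h0]; positivity
  · rw [div_mul_eq_mul_div, le_div_iff₀ hε]
    refine le_of_mul_le_mul_right ?_ h0
    linarith

/-- The comparison forces `⟨u, v - u⟩ ≥ 0`, and expanding `‖u + (v - u)‖²` finishes. With `δ = 0`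
the point `v` is an unregularized solution and the path is bounded by its norm; with `δ > 0` the
norms increase along the path and their increments control distances, which makes the path Cauchy.
-/
theorem regularized_vi_norm_sq_sub {T : E → E} {u v : E} {ε δ : ℝ} (hδ : 0 ≤ δ) (hδε : δ < ε)
    (hT : 0 ≤ inner ℝ (T u - T v) (u - v))
    (hu : 0 ≤ inner ℝ (T u + ε • u) (v - u)) (hv : 0 ≤ inner ℝ (T v + δ • v) (u - v)) :
    ‖v - u‖ ^ 2 ≤ ‖v‖ ^ 2 - ‖u‖ ^ 2 := by
  have h := regularized_vi_compare hT hu hv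
  have e : inner ℝ v (v - u) = inner ℝ u (v - u) + ‖v - u‖ ^ 2 := by
    rw [← real_inner_self_eq_norm_sq, ← inner_add_left, add_sub_cancel]
  have h0 : 0 ≤ inner ℝ u (v - u) := by
    have h1 : 0 ≤ (ε - δ) * inner ℝ u (v - u) := by
      rw [e] at h
      have : 0 ≤ δ * ‖v - u‖ ^ 2 := by positivity
      linarith
    exact nonneg_of_mul_nonneg_right h1 (by linarith)
  have e2 : ‖v‖ ^ 2 = ‖u‖ ^ 2 + 2 * inner ℝ u (v - u) + ‖v - u‖ ^ 2 := by
    rw [← norm_add_sq_real, add_sub_cancel]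
  linarith

/-- The Tikhonov trajectory converges to the solution of least norm. -/
theorem exists_tendsto_tikhonov [CompleteSpace E] {K : Set E} (hc : IsClosed K) {T : E → E}
    (hcont : Continuous T)
    (hmono : ∀ u ∈ K, ∀ v ∈ K, 0 ≤ inner ℝ (T u - T v) (u - v))
    {s : E} (hs : s ∈ K) (hsol : ∀ z ∈ K, 0 ≤ inner ℝ (T s) (z - s))
    {ε : ℕ → ℝ} (hε : ∀ n, 0 < ε n) (hanti : StrictAnti ε) (hlim : Tendsto ε atTop (𝓝 0))
    {y : ℕ → E} (hyK : ∀ n, y n ∈ K)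
    (hy : ∀ n, ∀ z ∈ K, 0 ≤ inner ℝ (T (y n) + ε n • y n) (z - y n)) :
    ∃ a ∈ K, (∀ z ∈ K, 0 ≤ inner ℝ (T a) (z - a)) ∧ Tendsto y atTop (𝓝 a) ∧
      (∀ b ∈ K, (∀ z ∈ K, 0 ≤ inner ℝ (T b) (z - b)) → ‖a‖ ≤ ‖b‖) := by
  have hbd : ∀ b ∈ K, (∀ z ∈ K, 0 ≤ inner ℝ (T b) (z - b)) → ∀ n, ‖y n‖ ≤ ‖b‖ := by
    intro b hb hbs n
    have h := regularized_vi_norm_sq_sub le_rfl (hε n) (hmono _ (hyK n) _ hb)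
      (hy n b hb) (by simpa using hbs (y n) (hyK n))
    have h2 : 0 ≤ ‖b - y n‖ ^ 2 := by positivity
    exact le_of_sq_le_sq (by linarith) (norm_nonneg _)
  have hstep : ∀ n m, n ≤ m → ‖y m - y n‖ ^ 2 ≤ ‖y m‖ ^ 2 - ‖y n‖ ^ 2 := by
    intro n m hnm
    rcases hnm.eq_or_lt with rfl | hlt
    · simp
    · exact regularized_vi_norm_sq_sub (hε m).le (hanti hlt) (hmono _ (hyK n) _ (hyK m))
        (hy n _ (hyK m)) (hy m _ (hyK n))
  have hmonoN : Monotone fun n => ‖y n‖ ^ 2 := by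
    intro n m hnm
    have := hstep n m hnm
    have h2 : 0 ≤ ‖y m - y n‖ ^ 2 := by positivity
    show ‖y n‖ ^ 2 ≤ ‖y m‖ ^ 2
    linarith
  have hconv : Tendsto (fun n => ‖y n‖ ^ 2) atTop (𝓝 (⨆ n, ‖y n‖ ^ 2)) := by
    refine tendsto_atTop_ciSup hmonoN ⟨‖s‖ ^ 2, ?_⟩
    rintro _ ⟨n, rfl⟩
    show ‖y n‖ ^ 2 ≤ ‖s‖ ^ 2
    gcongr
    exact hbd s hs hsol n
  have hcauchy : CauchySeq y := by
    rw [Metric.cauchySeq_iff']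
    intro r hr
    obtain ⟨n, hn⟩ := Metric.cauchySeq_iff'.1 hconv.cauchySeq (r ^ 2) (by positivity)
    refine ⟨n, fun m hm => ?_⟩
    have h1 := hn m hm
    rw [Real.dist_eq] at h1
    have h2 := (hstep n m hm).trans_lt ((le_abs_self _).trans_lt h1)
    rw [dist_eq_norm]
    exact lt_of_pow_lt_pow_left₀ 2 hr.le h2
  obtain ⟨a, ha⟩ := cauchySeq_tendsto_of_complete hcauchy
  refine ⟨a, hc.mem_of_tendsto ha (Eventually.of_forall hyK), fun z hz => ?_, ha,
    fun b hb hbs => ?_⟩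
  · have h1 : Tendsto (fun n => inner ℝ (T (y n) + ε n • y n) (z - y n)) atTop
        (𝓝 (inner ℝ (T a + (0 : ℝ) • a) (z - a))) :=
      (((hcont.tendsto a).comp ha).add (hlim.smul ha)).inner (tendsto_const_nhds.sub ha)
    have := ge_of_tendsto' h1 (fun n => hy n z hz)
    simpa using this
  · exact le_of_tendsto' ha.norm (hbd b hb hbs)

end VariationalInequality

/-! ### Joint actions, equilibria as solutions of a variational inequality, and bounds on costs. -/

namespace PayoffLearning

variable {N d : ℕ}

@[simp] theorem Joint.replace_apply_self (a : Joint N d) (i : Fin N) (z : Action d) :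
    a.replace i z i = z := by simp [Joint.replace]

theorem Joint.replace_apply_of_ne (a : Joint N d) {i j : Fin N} (h : j ≠ i) (z : Action d) :
    a.replace i z j = a j := by simp [Joint.replace, h]

@[simp] theorem Joint.replace_self (a : Joint N d) (i : Fin N) : a.replace i (a i) = a := by
  simp [Joint.replace]

@[simp] theorem Joint.replace_replace (a : Joint N d) (i : Fin N) (z w : Action d) :
    (a.replace i z).replace i w = a.replace i w := by simp [Joint.replace]

theorem Joint.replace_mem {G : Game N d} {a : Joint N d} (ha : a ∈ G.jointSet) (i : Fin N)
    {z : Action d} (hz : z ∈ G.A i) : a.replace i z ∈ G.jointSet := by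
  intro j
  by_cases h : j = i
  · subst h; simpa using hz
  · rw [Joint.replace_apply_of_ne _ h]; exact ha j

theorem Joint.inner_replace_sub (u a : Joint N d) (i : Fin N) (z : Action d) :
    inner ℝ u (a.replace i z - a) = inner ℝ (u i) (z - a i) := by
  rw [PiLp.inner_apply, Finset.sum_eq_single i]
  · simp
  · intro j _ hj
    simp [Joint.replace_apply_of_ne _ hj]
  · simp

theorem Joint.norm_sq_eq (a : Joint N d) : ‖a‖ ^ 2 = ∑ i, ‖a i‖ ^ 2 :=
  PiLp.norm_sq_eq_of_L2 _ a

theorem Joint.norm_apply_le (a : Joint N d) (i : Fin N) : ‖a i‖ ≤ ‖a‖ :=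
  PiLp.norm_apply_le a i

theorem Joint.norm_le_of_forall_norm_apply_le {a b : Joint N d} (h : ∀ i, ‖a i‖ ≤ ‖b i‖) :
    ‖a‖ ≤ ‖b‖ := by
  refine le_of_sq_le_sq ?_ (norm_nonneg _)
  rw [Joint.norm_sq_eq, Joint.norm_sq_eq]
  exact Finset.sum_le_sum fun i _ => pow_le_pow_left₀ (norm_nonneg _) (h i) 2

theorem Joint.contDiff_replace (a : Joint N d) (i : Fin N) : ContDiff ℝ 1 (a.replace i) := by
  unfold Joint.replace
  exact (PiLp.contDiff_toLp).comp (contDiff_update 1 a.ofLp i)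

theorem Joint.continuous_replace_left (i : Fin N) (z : Action d) :
    Continuous fun a : Joint N d => a.replace i z := by
  unfold Joint.replace
  exact (PiLp.continuous_toLp 2 _).comp
    ((PiLp.continuous_ofLp 2 _).update i continuous_const)

theorem Game.IsConvex.hasGradientAt {G : Game N d} (hG : G.IsConvex) (i : Fin N)
    (a : Joint N d) (z : Action d) :
    HasGradientAt (fun w => G.J i (a.replace i w)) (G.mapping (a.replace i z) i) z := by
  have h : DifferentiableAt ℝ (fun w => G.J i (a.replace i w)) z :=
    ((hG.contDiff_cost i).comp (Joint.contDiff_replace a i)).differentiable one_ne_zero z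
  simpa [Game.mapping] using h.hasGradientAt

theorem tendsto_slope_of_hasGradientAt {E : Type*} [NormedAddCommGroup E] [InnerProductSpace ℝ E]
    [CompleteSpace E] {f : E → ℝ} {g x : E} (h : HasGradientAt f g x) (v : E) :
    Tendsto (fun t : ℝ => t⁻¹ • (f (x + t • v) - f x)) (𝓝[>] 0) (𝓝 (inner ℝ g v)) := by
  have := (h.hasFDerivAt.hasLineDerivAt v).tendsto_slope_zero_right
  simpa using this

theorem inner_gradient_le_of_convexOn {E : Type*} [NormedAddCommGroup E] [InnerProductSpace ℝ E]
    [CompleteSpace E] {f : E → ℝ} (hf : ConvexOn ℝ Set.univ f) {g x : E}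
    (h : HasGradientAt f g x) (z : E) : inner ℝ g (z - x) ≤ f z - f x := by
  refine le_of_tendsto (tendsto_slope_of_hasGradientAt h (z - x)) ?_
  filter_upwards [Ioc_mem_nhdsGT (zero_lt_one' ℝ)] with t ht
  have h1 := hf.2 (Set.mem_univ x) (Set.mem_univ z) (sub_nonneg.2 ht.2) ht.1.le (by ring)
  have e : (1 - t) • x + t • z = x + t • (z - x) := by module
  rw [e] at h1
  simp only [smul_eq_mul] at h1 ⊢
  rw [inv_mul_le_iff₀ ht.1]
  linarith

theorem inner_gradient_nonneg_of_isMinOn {E : Type*} [NormedAddCommGroup E]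
    [InnerProductSpace ℝ E] [CompleteSpace E] {f : E → ℝ} {K : Set E} (hK : Convex ℝ K) {g x : E}
    (h : HasGradientAt f g x) (hx : x ∈ K) (hmin : ∀ z ∈ K, f x ≤ f z) {z : E} (hz : z ∈ K) :
    0 ≤ inner ℝ g (z - x) := by
  refine ge_of_tendsto (tendsto_slope_of_hasGradientAt h (z - x)) ?_
  filter_upwards [Ioc_mem_nhdsGT (zero_lt_one' ℝ)] with t ht
  have e : (1 - t) • x + t • z = x + t • (z - x) := by module
  have h1 := hmin _ (hK hx hz (sub_nonneg.2 ht.2) ht.1.le (by ring))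
  rw [e] at h1
  have := ht.1
  exact smul_nonneg (by positivity) (by linarith)

/-- Nash equilibria of a convex game are the solutions of its variational inequality. -/
theorem Game.IsConvex.isNash_iff {G : Game N d} (hG : G.IsConvex) (a : Joint N d) :
    G.IsNash a ↔ a ∈ viSol G.jointSet G.mapping := by
  constructor
  · rintro ⟨ha, hN⟩
    refine ⟨ha, fun z hz => ?_⟩
    rw [PiLp.inner_apply]
    refine Finset.sum_nonneg fun i _ => ?_
    have hg := hG.hasGradientAt i a (a i)
    rw [Joint.replace_self] at hg
    exact inner_gradient_nonneg_of_isMinOn (hG.convex_set i) hg (ha i)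
      (by simpa using hN i) (hz i)
  · rintro ⟨ha, hv⟩
    refine ⟨ha, fun i z hz => ?_⟩
    have h1 := hv _ (Joint.replace_mem ha i hz)
    rw [Joint.inner_replace_sub] at h1
    have hg := hG.hasGradientAt i a (a i)
    rw [Joint.replace_self] at hg
    have h2 := inner_gradient_le_of_convexOn (hG.convex_cost i a) hg z
    rw [Joint.replace_self] at h2
    linarith

theorem Game.LipschitzMapping.exists_bound {G : Game N d} (h : G.LipschitzMapping) :
    ∃ L : ℝ, 0 ≤ L ∧ (∀ i u v, ‖G.mapping u i - G.mapping v i‖ ≤ L * ‖u - v‖) ∧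
      ∀ u v, ‖G.mapping u - G.mapping v‖ ≤ L * ‖u - v‖ := by
  choose l hl using h
  have hb : ∀ i u v, ‖G.mapping u i - G.mapping v i‖ ≤ (∑ j, (l j : ℝ)) * ‖u - v‖ := by
    intro i u v
    refine ((hl i).norm_sub_le u v).trans ?_
    gcongr
    exact Finset.single_le_sum (f := fun j => (l j : ℝ)) (fun j _ => (l j).2) (Finset.mem_univ i)
  have hl0 : 0 ≤ ∑ j, (l j : ℝ) := Finset.sum_nonneg fun j _ => (l j).2
  have hN : (1 : ℝ) ≤ N + 1 := by linarith [(Nat.cast_nonneg N : (0 : ℝ) ≤ N)]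
  -- One constant serves both bounds: `N` blocks cost a factor `√N ≤ N + 1`, and `N + 1 ≥ 1` keeps
  -- the blockwise bound.
  refine ⟨(N + 1) * ∑ j, (l j : ℝ), by positivity, fun i u v => (hb i u v).trans ?_, fun u v => ?_⟩
  · gcongr
    exact le_mul_of_one_le_left hl0 hN
  · refine le_of_sq_le_sq ?_ (by positivity)
    rw [Joint.norm_sq_eq]
    calc ∑ i, ‖(G.mapping u - G.mapping v) i‖ ^ 2
        ≤ ∑ _i : Fin N, ((∑ j, (l j : ℝ)) * ‖u - v‖) ^ 2 := by
          gcongr with i; exact hb i u v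
      _ = N * ((∑ j, (l j : ℝ)) * ‖u - v‖) ^ 2 := by simp
      _ ≤ (N + 1) ^ 2 * ((∑ j, (l j : ℝ)) * ‖u - v‖) ^ 2 := by
          gcongr; nlinarith
      _ = _ := by ring

/-- The growth condition rules outside a large ball; inside it, continuity and compactness suffice.
-/
theorem Game.LinearGrowth.exists_bound {G : Game N d} (h : G.LinearGrowth)
    (hG : ∀ i, Continuous (G.J i)) :
    ∃ B : ℝ, 0 ≤ B ∧ ∀ i a, |G.J i a| ≤ B * (1 + ‖a‖) := by
  have h1 : ∀ i, ∃ B : ℝ, 0 ≤ B ∧ ∀ a, |G.J i a| ≤ B * (1 + ‖a‖) := by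
    intro i
    obtain ⟨c, hc0, hc⟩ := (h i).exists_nonneg
    rw [Asymptotics.isBigOWith_iff] at hc
    rw [(Metric.hasBasis_cobounded_compl_closedBall (0 : Joint N d)).eventually_iff] at hc
    obtain ⟨r, -, hr⟩ := hc
    obtain ⟨D, hD⟩ := (isCompact_closedBall (0 : Joint N d) r).exists_bound_of_continuousOn
      (hG i).continuousOn
    refine ⟨c + |D|, by positivity, fun a => ?_⟩
    have hn := norm_nonneg a
    by_cases ha : a ∈ Metric.closedBall (0 : Joint N d) r
    · have := hD a ha
      rw [Real.norm_eq_abs] at this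
      have h3 := le_abs_self D
      have h4 : 0 ≤ (c + |D|) * ‖a‖ := by positivity
      linarith
    · have := hr ha
      rw [Real.norm_eq_abs, norm_norm] at this
      have h4 : 0 ≤ |D| * ‖a‖ := by positivity
      have h5 := abs_nonneg D
      linarith
  choose B hB0 hB using h1
  refine ⟨∑ i, B i, Finset.sum_nonneg fun i _ => hB0 i, fun i a => (hB i a).trans ?_⟩
  gcongr
  exact Finset.single_le_sum (f := B) (fun j _ => hB0 j) (Finset.mem_univ i)

/-- First-order Taylor estimate of a cost in the own action of the player, at a perturbed point. -/
theorem Game.IsConvex.taylor {G : Game N d} (hG : G.IsConvex) {L : ℝ} (hL : 0 ≤ L) (i : Fin N)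
    (hlip : ∀ u v, ‖G.mapping u i - G.mapping v i‖ ≤ L * ‖u - v‖) (m h : Joint N d) :
    |G.J i (m + h) - G.J i ((m + h).replace i (m i)) - inner ℝ (G.mapping m i) (h i)|
      ≤ L * ‖h‖ ^ 2 := by
  -- Mean value inequality on a ball containing both own actions: for `z` in it, each block of `(m +
  -- h).replace i z - m` is at most that of `h`, so the gradient stays within `L * ‖h‖` of its value
  -- at `m`.
  have key := (convex_closedBall (m i) ‖h i‖).norm_image_sub_le_of_norm_hasFDerivWithin_le'
    (f := fun w => G.J i ((m + h).replace i w))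
    (φ := (InnerProductSpace.toDual ℝ (Action d)) (G.mapping m i)) (C := L * ‖h‖)
    (fun z _ => (hG.hasGradientAt i (m + h) z).hasFDerivAt.hasFDerivWithinAt) ?_
    (Metric.mem_closedBall_self (norm_nonneg _)) (y := (m + h) i) (by simp)
  · rw [Joint.replace_self] at key
    simp only [PiLp.add_apply, add_sub_cancel_left, InnerProductSpace.toDual_apply_apply,
      Real.norm_eq_abs] at key
    refine key.trans ?_
    rw [sq, ← mul_assoc]
    gcongr
    exact Joint.norm_apply_le h i
  · intro z hz
    rw [← map_sub, LinearIsometryEquiv.norm_map]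
    refine (hlip _ _).trans ?_
    gcongr
    refine Joint.norm_le_of_forall_norm_apply_le fun j => ?_
    by_cases hj : j = i
    · subst hj; simpa [dist_eq_norm] using hz
    · simp [Joint.replace_apply_of_ne _ hj]

end PayoffLearning

/-! ### Gaussian sampling: bias and second moment of the payoff-based estimate. -/

namespace PayoffLearning

variable {N d : ℕ}

/-- Both sides have the same characteristic function. All sampling is thereby expressed through one
fixed measure, with mean and deviation moved into the integrand. -/
theorem playLaw_eq (m : Joint N d) (s : ℝ) :
    playLaw m s = (stdGaussian (Joint N d)).map (fun z => m + s • z) := by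
  have hmeas : ∀ i : Fin N, IsProbabilityMeasure ((Measure.pi fun k : Fin d =>
      gaussianReal (m i k) (Real.toNNReal (s ^ 2))).map (WithLp.toLp 2)) := fun i =>
    Measure.isProbabilityMeasure_map (by fun_prop)
  have h1 : IsProbabilityMeasure (playLaw m s) := Measure.isProbabilityMeasure_map (by fun_prop)
  have h2 : IsProbabilityMeasure ((stdGaussian (Joint N d)).map (fun z => m + s • z)) :=
    Measure.isProbabilityMeasure_map (by fun_prop)
  refine Measure.ext_of_charFun (funext fun t => ?_)
  have e : (fun z : Joint N d => m + s • z) = (m + ·) ∘ (s • ·) := rfl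
  rw [e, ← Measure.map_map (by fun_prop) (by fun_prop), charFun_map_const_add, charFun_map_smul,
    charFun_stdGaussian, playLaw, charFun_pi]
  simp_rw [charFun_pi, charFun_gaussianReal]
  simp_rw [← Complex.exp_sum, ← Complex.exp_add]
  congr 1
  simp_rw [Finset.sum_sub_distrib]
  have hn : ((‖s • t‖ : ℝ) : ℂ) ^ 2 = (s : ℂ) ^ 2 * ∑ i, ∑ k, (t i k : ℂ) ^ 2 := by
    have : ‖s • t‖ ^ 2 = s ^ 2 * ∑ i, ∑ k, (t i k) ^ 2 := by
      rw [norm_smul, mul_pow, Joint.norm_sq_eq, Real.norm_eq_abs, sq_abs]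
      simp_rw [EuclideanSpace.norm_sq_eq, Real.norm_eq_abs, sq_abs]
    exact_mod_cast congrArg (fun r : ℝ => (r : ℂ)) this
  have hi : ((inner ℝ m t : ℝ) : ℂ) = ∑ i, ∑ k, (t i k : ℂ) * (m i k : ℂ) := by
    have : inner ℝ m t = ∑ i, ∑ k, t i k * m i k := by
      simp [PiLp.inner_apply]
    exact_mod_cast congrArg (fun r : ℝ => (r : ℂ)) this
  have hs : ((s ^ 2).toNNReal : ℂ) = (s : ℂ) ^ 2 := by
    have : ((s ^ 2).toNNReal : ℝ) = s ^ 2 := Real.coe_toNNReal _ (sq_nonneg s)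
    exact_mod_cast congrArg (fun r : ℝ => (r : ℂ)) this
  rw [hn, hi, hs]
  simp_rw [← Finset.sum_mul, ← Finset.sum_div, ← Finset.mul_sum]
  ring

theorem integrable_norm_pow_stdGaussian (k : ℕ) :
    Integrable (fun z : Joint N d => ‖z‖ ^ k) (stdGaussian (Joint N d)) := by
  rcases k with _ | k
  · simp
  · exact (IsGaussian.memLp_id (stdGaussian (Joint N d)) ((k + 1 : ℕ) : ENNReal)
      (by simp)).integrable_norm_pow (by simp)

theorem integral_inner_mul_inner_stdGaussian (u v : Joint N d) :
    ∫ z, inner ℝ u z * inner ℝ v z ∂(stdGaussian (Joint N d)) = inner ℝ u v := by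
  have h := covarianceBilin_apply (μ := stdGaussian (Joint N d))
    (IsGaussian.memLp_id _ 2 (by simp)) u v
  rw [covarianceBilin_stdGaussian] at h
  simpa [innerSL_apply_apply ℝ] using h.symm

/-- Change of sign of the action of player `i`. -/
noncomputable def blockFlip (i : Fin N) : Joint N d ≃ₗᵢ[ℝ] Joint N d :=
  LinearIsometryEquiv.piLpCongrRight 2
    fun j => if j = i then LinearIsometryEquiv.neg ℝ else LinearIsometryEquiv.refl ℝ _

theorem blockFlip_apply_self (i : Fin N) (z : Joint N d) : blockFlip i z i = - z i := by
  simp [blockFlip]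

theorem blockFlip_apply_of_ne {i j : Fin N} (h : j ≠ i) (z : Joint N d) :
    blockFlip i z j = z j := by
  simp [blockFlip, h]

/-- The standard Gaussian is invariant under linear isometries, in particular under a sign change in
one block. -/
theorem integral_eq_zero_of_blockFlip {i : Fin N} {F : Joint N d → ℝ}
    (hF : ∀ z, F (blockFlip i z) = - F z) : ∫ z, F z ∂(stdGaussian (Joint N d)) = 0 := by
  have h : ∫ z, F z ∂(stdGaussian (Joint N d))
      = ∫ z, F (blockFlip i z) ∂(stdGaussian (Joint N d)) := by
    conv_lhs => rw [← stdGaussian_map (blockFlip (d := d) i)]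
    exact (blockFlip i).toHomeomorph.measurableEmbedding.integral_map F
  simp_rw [hF, integral_neg] at h
  linarith

/-- The payoff-based estimate of the game mapping at `m`, from the joint action `x`. -/
noncomputable def Game.estimate (G : Game N d) (s : ℝ) (m x : Joint N d) : Joint N d :=
  WithLp.toLp 2 fun i => (G.J i x / s ^ 2) • (x i - m i)

theorem Game.continuous_estimate {G : Game N d} (hG : ∀ i, Continuous (G.J i)) (s : ℝ) :
    Continuous fun p : Joint N d × Joint N d => G.estimate s p.1 p.2 := by
  unfold Game.estimate
  refine (PiLp.continuous_toLp 2 _).comp (continuous_pi fun i => ?_)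
  have := hG i
  fun_prop

theorem Game.estimate_add_smul (G : Game N d) {s : ℝ} (hs : 0 < s) (m z : Joint N d) (i : Fin N) :
    G.estimate s m (m + s • z) i = (G.J i (m + s • z) / s) • z i := by
  simp only [Game.estimate, PiLp.add_apply, PiLp.smul_apply, add_sub_cancel_left, smul_smul]
  congr 1
  field_simp

theorem Game.norm_estimate_le {G : Game N d} {B : ℝ} (hB : 0 ≤ B)
    (hJ : ∀ i a, |G.J i a| ≤ B * (1 + ‖a‖)) {s : ℝ} (hs : 0 < s) (m z : Joint N d) :
    ‖G.estimate s m (m + s • z)‖ ≤ B * (1 + ‖m‖ + s * ‖z‖) / s * ‖z‖ := by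
  refine le_of_sq_le_sq ?_ (by positivity)
  rw [mul_pow, Joint.norm_sq_eq, Joint.norm_sq_eq, Finset.mul_sum]
  refine Finset.sum_le_sum fun i _ => ?_
  rw [G.estimate_add_smul hs, norm_smul, mul_pow, Real.norm_eq_abs, abs_div, abs_of_pos hs]
  gcongr
  refine (hJ i _).trans ?_
  rw [add_assoc]
  gcongr
  refine (norm_add_le _ _).trans ?_
  rw [norm_smul, Real.norm_of_nonneg hs.le]

theorem Game.norm_estimate_sq_le {G : Game N d} {B : ℝ} (hB : 0 ≤ B)
    (hJ : ∀ i a, |G.J i a| ≤ B * (1 + ‖a‖)) {s : ℝ} (hs : 0 < s) (m z : Joint N d) :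
    ‖G.estimate s m (m + s • z)‖ ^ 2 ≤
      3 * B ^ 2 / s ^ 2 * ((1 + ‖m‖ ^ 2) * ‖z‖ ^ 2 + s ^ 2 * ‖z‖ ^ 4) := by
  refine (pow_le_pow_left₀ (norm_nonneg _) (Game.norm_estimate_le hB hJ hs m z) 2).trans ?_
  have h : (1 + ‖m‖ + s * ‖z‖) ^ 2 ≤ 3 * (1 + ‖m‖ ^ 2 + (s * ‖z‖) ^ 2) := by
    nlinarith [sq_nonneg (1 - ‖m‖), sq_nonneg (1 - s * ‖z‖), sq_nonneg (‖m‖ - s * ‖z‖)]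
  calc (B * (1 + ‖m‖ + s * ‖z‖) / s * ‖z‖) ^ 2
      = B ^ 2 / s ^ 2 * ((1 + ‖m‖ + s * ‖z‖) ^ 2 * ‖z‖ ^ 2) := by ring
    _ ≤ B ^ 2 / s ^ 2 * ((3 * (1 + ‖m‖ ^ 2 + (s * ‖z‖) ^ 2)) * ‖z‖ ^ 2) := by gcongr
    _ = _ := by ring

theorem Game.aestronglyMeasurable_estimate {G : Game N d} (hG : ∀ i, Continuous (G.J i)) (s : ℝ)
    (m : Joint N d) : AEStronglyMeasurable (fun z => G.estimate s m (m + s • z))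
      (stdGaussian (Joint N d)) :=
  ((Game.continuous_estimate hG s).comp
    (by fun_prop : Continuous fun z : Joint N d => (m, m + s • z))).aestronglyMeasurable

theorem Game.memLp_estimate {G : Game N d} (hG : ∀ i, Continuous (G.J i)) {B : ℝ} (hB : 0 ≤ B)
    (hJ : ∀ i a, |G.J i a| ≤ B * (1 + ‖a‖)) {s : ℝ} (hs : 0 < s) (m : Joint N d) :
    MemLp (fun z => G.estimate s m (m + s • z)) 2 (stdGaussian (Joint N d)) := by
  rw [memLp_two_iff_integrable_sq_norm (Game.aestronglyMeasurable_estimate hG s m)]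
  refine Integrable.mono' ((((integrable_norm_pow_stdGaussian 2).const_mul (1 + ‖m‖ ^ 2)).add
    ((integrable_norm_pow_stdGaussian 4).const_mul (s ^ 2))).const_mul (3 * B ^ 2 / s ^ 2))
    ((Game.aestronglyMeasurable_estimate hG s m).norm.pow 2) (ae_of_all _ fun z => ?_)
  rw [Real.norm_of_nonneg (by positivity)]
  exact Game.norm_estimate_sq_le hB hJ hs m z

theorem Game.integral_norm_estimate_sq_le {G : Game N d} (hG : ∀ i, Continuous (G.J i)) {B : ℝ}
    (hB : 0 ≤ B) (hJ : ∀ i a, |G.J i a| ≤ B * (1 + ‖a‖)) {s : ℝ} (hs : 0 < s) (m : Joint N d) :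
    ∫ z, ‖G.estimate s m (m + s • z)‖ ^ 2 ∂(stdGaussian (Joint N d)) ≤
      3 * B ^ 2 / s ^ 2 * ((1 + ‖m‖ ^ 2) * (∫ z, ‖z‖ ^ 2 ∂(stdGaussian (Joint N d)))
        + s ^ 2 * ∫ z, ‖z‖ ^ 4 ∂(stdGaussian (Joint N d))) := by
  have hi2 := (integrable_norm_pow_stdGaussian (N := N) (d := d) 2).const_mul (1 + ‖m‖ ^ 2)
  have hi4 := (integrable_norm_pow_stdGaussian (N := N) (d := d) 4).const_mul (s ^ 2)
  rw [← integral_const_mul, ← integral_const_mul, ← integral_add hi2 hi4, ← integral_const_mul]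
  exact integral_mono (Game.memLp_estimate hG hB hJ hs m).integrable_norm_pow'
    ((hi2.add hi4).const_mul _) fun z => Game.norm_estimate_sq_le hB hJ hs m z

/-- The bias of one block of the payoff-based estimate is of the order of the deviation `s`. -/
theorem Game.IsConvex.abs_integral_block_sub_le {G : Game N d} (hG : G.IsConvex) {L : ℝ}
    (hL : 0 ≤ L) (hlip : ∀ i u v, ‖G.mapping u i - G.mapping v i‖ ≤ L * ‖u - v‖)
    {B : ℝ} (hB : 0 ≤ B) (hJ : ∀ i a, |G.J i a| ≤ B * (1 + ‖a‖)) {s : ℝ} (hs : 0 < s)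
    (m w : Joint N d) (i : Fin N) :
    |(∫ z, inner ℝ (G.estimate s m (m + s • z) i) (w i) ∂(stdGaussian (Joint N d)))
        - inner ℝ (G.mapping m i) (w i)|
      ≤ L * (∫ z, ‖z‖ ^ 3 ∂(stdGaussian (Joint N d))) * s * ‖w‖ := by
  have hJc : ∀ i, Continuous (G.J i) := fun i => (hG.contDiff_cost i).continuous
  have hest : Integrable (fun z => inner ℝ (G.estimate s m (m + s • z) i) (w i))
      (stdGaussian (Joint N d)) := by
    have h1 := (Game.memLp_estimate hJc hB hJ hs m).integrable (by norm_num)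
    refine Integrable.mono' (h1.norm.mul_const ‖w‖) ?_ (ae_of_all _ fun z => ?_)
    · have := Game.continuous_estimate hJc s
      have h2 : Continuous fun z : Joint N d => G.estimate s m (m + s • z) :=
        this.comp (by fun_prop : Continuous fun z : Joint N d => (m, m + s • z))
      exact Continuous.aestronglyMeasurable (by fun_prop)
    · refine (norm_inner_le_norm _ _).trans ?_
      gcongr <;> exact Joint.norm_apply_le _ i
  -- `F` is the part of the estimate with the own action reset to its mean, odd under `blockFlip i`;
  -- `Q` is the linear Taylor term, whose mean is the wanted inner product.
  set F : Joint N d → ℝ := fun z => G.J i ((m + s • z).replace i (m i)) / s * inner ℝ (z i) (w i)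
  set Q : Joint N d → ℝ := fun z => inner ℝ (G.mapping m i) (z i) * inner ℝ (w i) (z i)
  have hF0 : ∫ z, F z ∂(stdGaussian (Joint N d)) = 0 := by
    refine integral_eq_zero_of_blockFlip (i := i) fun z => ?_
    have e : (m + s • blockFlip i z).replace i (m i) = (m + s • z).replace i (m i) := by
      ext j : 1
      by_cases hj : j = i
      · subst hj; simp
      · simp [Joint.replace_apply_of_ne _ hj, blockFlip_apply_of_ne hj]
    simp only [F, e, blockFlip_apply_self, inner_neg_left, mul_neg]
  have hblock : ∀ (u : Action d) (z : Joint N d),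
      inner ℝ (Joint.replace 0 i u) z = inner ℝ u (z i) := by
    intro u z
    have h := Joint.inner_replace_sub z 0 i u
    rw [sub_zero] at h
    rw [real_inner_comm, h, real_inner_comm]; simp
  have hQ1 : ∫ z, Q z ∂(stdGaussian (Joint N d)) = inner ℝ (G.mapping m i) (w i) := by
    have h := integral_inner_mul_inner_stdGaussian (Joint.replace 0 i (G.mapping m i))
      (Joint.replace 0 i (w i))
    simpa only [hblock, Joint.replace_apply_self] using h
  have hinner_le : ∀ z : Joint N d, |inner ℝ (z i) (w i)| ≤ ‖z‖ * ‖w‖ := fun z =>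
    (abs_real_inner_le_norm _ _).trans
      (mul_le_mul (Joint.norm_apply_le _ i) (Joint.norm_apply_le _ i) (norm_nonneg _)
        (norm_nonneg _))
  have hQi : Integrable Q (stdGaussian (Joint N d)) := by
    refine Integrable.mono' ((integrable_norm_pow_stdGaussian 2).const_mul
      (‖G.mapping m i‖ * ‖w‖)) (Continuous.aestronglyMeasurable (by fun_prop))
      (ae_of_all _ fun z => ?_)
    have h1 : |inner ℝ (G.mapping m i) (z i)| ≤ ‖G.mapping m i‖ * ‖z‖ :=
      (abs_real_inner_le_norm _ _).trans (by gcongr; exact Joint.norm_apply_le _ i)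
    have h2 := hinner_le z
    rw [real_inner_comm] at h2
    simp only [Q, norm_mul, Real.norm_eq_abs]
    calc |inner ℝ (G.mapping m i) (z i)| * |inner ℝ (w i) (z i)|
        ≤ (‖G.mapping m i‖ * ‖z‖) * (‖z‖ * ‖w‖) := by gcongr
      _ = _ := by ring
  -- The Taylor remainder is quadratic in `s • z`; division by `s` and the factor `z i` leave `s *
  -- ‖z‖ ^ 3`.
  have hrem : ∀ z, |inner ℝ (G.estimate s m (m + s • z) i) (w i) - F z - Q z|
      ≤ L * s * ‖w‖ * ‖z‖ ^ 3 := by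
    intro z
    have ht := hG.taylor hL i (hlip i) m (s • z)
    have e : inner ℝ (G.estimate s m (m + s • z) i) (w i) - F z - Q z
        = (G.J i (m + s • z) - G.J i ((m + s • z).replace i (m i))
            - inner ℝ (G.mapping m i) ((s • z) i)) / s * inner ℝ (z i) (w i) := by
      rw [G.estimate_add_smul hs]
      simp only [F, Q, real_inner_smul_left, PiLp.smul_apply, real_inner_smul_right,
        real_inner_comm (z i) (w i)]
      field_simp
    rw [e, abs_mul, abs_div, abs_of_pos hs]
    rw [norm_smul, Real.norm_of_nonneg hs.le] at ht
    calc _ ≤ L * (s * ‖z‖) ^ 2 / s * (‖z‖ * ‖w‖) := by gcongr; exact hinner_le z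
      _ = _ := by field_simp
  -- `F` needs no growth bound of its own: it is the estimate minus `Q` minus the remainder, all
  -- integrable.
  have hFi : Integrable F (stdGaussian (Joint N d)) := by
    have hmeas : AEStronglyMeasurable F (stdGaussian (Joint N d)) := by
      have h1 : Continuous fun z : Joint N d => G.J i ((m + s • z).replace i (m i)) :=
        (hJc i).comp ((Joint.continuous_replace_left i (m i)).comp (by fun_prop))
      exact Continuous.aestronglyMeasurable (by fun_prop)
    have h2 : Integrable (fun z => inner ℝ (G.estimate s m (m + s • z) i) (w i) - F z - Q z)
        (stdGaussian (Joint N d)) :=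
      Integrable.mono' ((integrable_norm_pow_stdGaussian 3).const_mul (L * s * ‖w‖))
        ((hest.aestronglyMeasurable.sub hmeas).sub hQi.aestronglyMeasurable)
        (ae_of_all _ hrem)
    refine ((hest.sub hQi).sub h2).congr (ae_of_all _ fun z => ?_)
    simp
  have hsplit : (∫ z, inner ℝ (G.estimate s m (m + s • z) i) (w i) ∂(stdGaussian (Joint N d)))
        - inner ℝ (G.mapping m i) (w i)
      = ∫ z, (inner ℝ (G.estimate s m (m + s • z) i) (w i) - F z - Q z)
        ∂(stdGaussian (Joint N d)) := by
    have h1 := integral_sub (hest.sub hFi) hQi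
    simp only [Pi.sub_apply] at h1
    rw [h1, integral_sub hest hFi, hF0, hQ1, sub_zero]
  rw [hsplit]
  refine (norm_integral_le_of_norm_le
    ((integrable_norm_pow_stdGaussian 3).const_mul (L * s * ‖w‖))
    (ae_of_all _ fun z => (Real.norm_eq_abs _).trans_le (hrem z))).trans ?_
  rw [integral_const_mul]
  exact le_of_eq (by ring)

theorem Game.IsConvex.abs_integral_inner_estimate_sub_le {G : Game N d} (hG : G.IsConvex) {L : ℝ}
    (hL : 0 ≤ L) (hlip : ∀ i u v, ‖G.mapping u i - G.mapping v i‖ ≤ L * ‖u - v‖)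
    {B : ℝ} (hB : 0 ≤ B) (hJ : ∀ i a, |G.J i a| ≤ B * (1 + ‖a‖)) {s : ℝ} (hs : 0 < s)
    (m w : Joint N d) :
    |(∫ z, inner ℝ (G.estimate s m (m + s • z)) w ∂(stdGaussian (Joint N d)))
        - inner ℝ (G.mapping m) w|
      ≤ N * (L * ∫ z, ‖z‖ ^ 3 ∂(stdGaussian (Joint N d))) * s * ‖w‖ := by
  have hJc : ∀ i, Continuous (G.J i) := fun i => (hG.contDiff_cost i).continuous
  have hInt : ∀ i ∈ Finset.univ, Integrable
      (fun z => inner ℝ (G.estimate s m (m + s • z) i) (w i)) (stdGaussian (Joint N d)) := by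
    intro i _
    have h1 := (Game.memLp_estimate hJc hB hJ hs m).integrable (by norm_num)
    refine (h1.inner_const (Joint.replace 0 i (w i))).congr (ae_of_all _ fun z => ?_)
    have h := Joint.inner_replace_sub (G.estimate s m (m + s • z)) 0 i (w i)
    simpa using h
  have hsum : ∀ u : Joint N d, inner ℝ u w = ∑ i, inner ℝ (u i) (w i) := fun u =>
    PiLp.inner_apply u w
  simp_rw [hsum]
  rw [integral_finsetSum _ hInt, ← Finset.sum_sub_distrib]
  refine (Finset.abs_sum_le_sum_abs _ _).trans ?_
  refine (Finset.sum_le_sum fun i _ => hG.abs_integral_block_sub_le hL hlip hB hJ hs m w i).trans ?_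
  simp only [Finset.sum_const, Finset.card_univ, Fintype.card_fin, nsmul_eq_mul]
  exact le_of_eq (by ring)

end PayoffLearning

/-! ### The mean square effect of one step. -/

namespace PayoffLearning

variable {N d : ℕ}

theorem norm_sub_smul_add_sub_sq {E : Type*} [NormedAddCommGroup E] [InnerProductSpace ℝ E]
    (m y g v : E) (β ε : ℝ) :
    ‖(m - β • (g + ε • m)) - (y - β • (v + ε • y))‖ ^ 2
      = ‖m - y‖ ^ 2 - 2 * β * (inner ℝ g (m - y) - inner ℝ v (m - y) + ε * ‖m - y‖ ^ 2)
        + β ^ 2 * ‖g - v + ε • (m - y)‖ ^ 2 := by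
  have e : (m - β • (g + ε • m)) - (y - β • (v + ε • y))
      = (m - y) - β • (g - v + ε • (m - y)) := by module
  rw [e, norm_sub_sq_real, real_inner_smul_right, norm_smul, mul_pow, Real.norm_eq_abs, sq_abs,
    inner_add_right, inner_sub_right, real_inner_smul_right, real_inner_self_eq_norm_sq,
    real_inner_comm g, real_inner_comm v]
  ring

theorem Game.integrable_step_sq {G : Game N d} (hG : ∀ i, Continuous (G.J i)) {B : ℝ}
    (hB : 0 ≤ B) (hJ : ∀ i a, |G.J i a| ≤ B * (1 + ‖a‖)) {s : ℝ} (hs : 0 < s) (β ε : ℝ)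
    (m v : Joint N d) :
    Integrable (fun z => ‖(m - β • (G.estimate s m (m + s • z) + ε • m)) - v‖ ^ 2)
      (stdGaussian (Joint N d)) := by
  have h := Game.memLp_estimate hG hB hJ hs m
  exact (((memLp_const m).sub ((h.add (memLp_const (ε • m))).const_smul β)).sub
    (memLp_const v)).integrable_norm_pow'

theorem integral_const_sub_mul_add_mul {α : Type*} [MeasurableSpace α] {ν : Measure α}
    [IsProbabilityMeasure ν] {f h : α → ℝ} (hf : Integrable f ν) (hh : Integrable h ν)
    (a b c e k l r : ℝ) :
    ∫ z, (a - b * (f z - c + e) + k * (l * (h z + r))) ∂ν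
      = a - b * ((∫ z, f z ∂ν) - c + e) + k * (l * ((∫ z, h z ∂ν) + r)) := by
  have h1 : Integrable (fun z => f z - c) ν := hf.sub (integrable_const c)
  have h2 : Integrable (fun z => b * (f z - c + e)) ν := (h1.add (integrable_const e)).const_mul b
  have h3 : Integrable (fun z => a - b * (f z - c + e)) ν := (integrable_const a).sub h2
  have h4 : Integrable (fun z => k * (l * (h z + r))) ν :=
    ((hh.add (integrable_const r)).const_mul l).const_mul k
  rw [integral_add h3 h4, integral_sub (integrable_const a) h2, integral_const_mul,
    integral_add h1 (integrable_const e), integral_sub hf (integrable_const c),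
    integral_const_mul, integral_const_mul, integral_add hh (integrable_const r)]
  simp

theorem sq_norm_le_of_norm_le_add {a b c : ℝ} (ha : 0 ≤ a) (h : a ≤ b + c) :
    a ^ 2 ≤ 2 * b ^ 2 + 2 * c ^ 2 := by
  refine (pow_le_pow_left₀ ha h 2).trans ?_
  nlinarith [sq_nonneg (b - c)]

set_option maxHeartbeats 800000 in
/-- The mean square distance to a regularized solution after one step of the algorithm. -/
theorem Game.exists_integral_step_sq_le {G : Game N d} (hG : G.IsConvex)
    (hmono : IsMonotoneOver G.mapping G.jointSet) (hlip : G.LipschitzMapping)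
    (hgrowth : G.LinearGrowth) {S Y : ℝ} (hY : 0 ≤ Y) :
    ∃ C : ℝ, 0 ≤ C ∧ ∀ γ s ε : ℝ, 0 < γ → 0 < s → s ≤ S → 0 < ε → ε ≤ S →
      ∀ y ∈ G.jointSet, ‖y‖ ≤ Y → ∀ m ∈ G.jointSet,
      ∫ z, ‖(m - (γ * s ^ 2) • (G.estimate s m (m + s • z) + ε • m))
          - (y - (γ * s ^ 2) • (G.mapping y + ε • y))‖ ^ 2 ∂(stdGaussian (Joint N d))
        ≤ (1 - 2 * (γ * s ^ 2 * ε)) * ‖m - y‖ ^ 2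
          + C * (γ * s ^ 2 * s + γ ^ 2) * (1 + ‖m - y‖ ^ 2) := by
  have hJc : ∀ i, Continuous (G.J i) := fun i => (hG.contDiff_cost i).continuous
  obtain ⟨L, hL, hLi, hLu⟩ := hlip.exists_bound
  obtain ⟨B, hB, hJ⟩ := hgrowth.exists_bound hJc
  set C₁ : ℝ := N * (L * ∫ z, ‖z‖ ^ 3 ∂(stdGaussian (Joint N d))) with hC₁
  set K₂ : ℝ := ∫ z, ‖z‖ ^ 2 ∂(stdGaussian (Joint N d)) with hK₂
  set K₄ : ℝ := ∫ z, ‖z‖ ^ 4 ∂(stdGaussian (Joint N d)) with hK₄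
  have hK₂0 : 0 ≤ K₂ := integral_nonneg fun z => by positivity
  have hK₄0 : 0 ≤ K₄ := integral_nonneg fun z => by positivity
  have hC₁0 : 0 ≤ C₁ :=
    mul_nonneg (Nat.cast_nonneg _) (mul_nonneg hL (integral_nonneg fun z => by positivity))
  set D : ℝ := ‖G.mapping 0‖ + L * Y with hD
  -- `C₁` is the bias constant, `D` bounds the game mapping on the ball of radius `Y`, and `C₂` is
  -- the second moment constant. None of them depends on `γ`, `s`, `ε`, `m` or `y`.
  have hD0 : 0 ≤ D := by positivity
  set C₂ : ℝ := 3 * B ^ 2 * (K₂ + S ^ 2 * K₄) with hC₂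
  have hC₂0 : 0 ≤ C₂ := by positivity
  set C : ℝ := C₁ + 3 * (S ^ 2 * C₂ * (1 + 2 * Y ^ 2 + 2) + S ^ 4 * D ^ 2 + S ^ 6) with hC
  refine ⟨C, by positivity, fun γ s ε hγ hs hsS hε hεS y hyA hyY m hmA => ?_⟩
  set ν := stdGaussian (Joint N d)
  set β : ℝ := γ * s ^ 2 with hβ
  have hβ0 : 0 < β := by positivity
  set w : Joint N d := m - y with hw
  set g : Joint N d → Joint N d := fun z => G.estimate s m (m + s • z) with hg
  have hgL : MemLp g 2 ν := Game.memLp_estimate hJc hB hJ hs m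
  have hgi : Integrable g ν := hgL.integrable (by norm_num)
  have hMy : ‖G.mapping y‖ ≤ D := by
    have h1 := hLu y 0
    rw [sub_zero] at h1
    have h2 : ‖G.mapping y‖ ≤ ‖G.mapping 0‖ + ‖G.mapping y - G.mapping 0‖ :=
      norm_le_norm_add_norm_sub' _ _
    have h3 : L * ‖y‖ ≤ L * Y := by gcongr
    linarith
  have hbias := hG.abs_integral_inner_estimate_sub_le hL hLi hB hJ hs m w
  have hbias' := (abs_le.1 hbias).1
  have hmon : 0 ≤ inner ℝ (G.mapping m) w - inner ℝ (G.mapping y) w := by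
    rw [← inner_sub_left]; exact hmono m hmA y hyA
  have hsec : ∫ z, ‖g z‖ ^ 2 ∂ν ≤ C₂ * (1 + ‖m‖ ^ 2) / s ^ 2 := by
    refine (Game.integral_norm_estimate_sq_le hJc hB hJ hs m).trans ?_
    rw [hC₂, ← hK₂, ← hK₄, div_mul_eq_mul_div]
    gcongr ?_ / _
    have h1 : s ^ 2 * K₄ ≤ S ^ 2 * K₄ * (1 + ‖m‖ ^ 2) := by
      have h2 : s ^ 2 * K₄ ≤ S ^ 2 * K₄ := by gcongr
      have h3 : 0 ≤ S ^ 2 * K₄ * ‖m‖ ^ 2 := by positivity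
      linarith
    calc 3 * B ^ 2 * ((1 + ‖m‖ ^ 2) * K₂ + s ^ 2 * K₄)
        ≤ 3 * B ^ 2 * ((1 + ‖m‖ ^ 2) * K₂ + S ^ 2 * K₄ * (1 + ‖m‖ ^ 2)) := by gcongr
      _ = _ := by ring
  have hsq : ∀ z, ‖g z - G.mapping y + ε • w‖ ^ 2
      ≤ 3 * (‖g z‖ ^ 2 + (D ^ 2 + S ^ 2 * ‖w‖ ^ 2)) := by
    intro z
    have h1 : ‖g z - G.mapping y + ε • w‖ ≤ ‖g z‖ + D + S * ‖w‖ := by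
      refine (norm_add_le _ _).trans ?_
      rw [norm_smul, Real.norm_of_nonneg hε.le]
      gcongr
      exact (norm_sub_le _ _).trans (by gcongr)
    refine (pow_le_pow_left₀ (norm_nonneg _) h1 2).trans ?_
    nlinarith [sq_nonneg (‖g z‖ - D), sq_nonneg (‖g z‖ - S * ‖w‖), sq_nonneg (D - S * ‖w‖)]
  have hgn : Integrable (fun z => ‖g z‖ ^ 2) ν := hgL.integrable_norm_pow'
  have hgw : Integrable (fun z => inner ℝ (g z) w) ν := hgi.inner_const w
  have hup : ∫ z, ‖(m - β • (g z + ε • m)) - (y - β • (G.mapping y + ε • y))‖ ^ 2 ∂ν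
      ≤ ∫ z, (‖w‖ ^ 2 - 2 * β * (inner ℝ (g z) w - inner ℝ (G.mapping y) w + ε * ‖w‖ ^ 2)
        + β ^ 2 * (3 * (‖g z‖ ^ 2 + (D ^ 2 + S ^ 2 * ‖w‖ ^ 2)))) ∂ν := by
    refine integral_mono (Game.integrable_step_sq hJc hB hJ hs β ε m _) ?_ fun z => ?_
    · exact ((integrable_const _).sub (((hgw.sub (integrable_const _)).add
        (integrable_const _)).const_mul _)).add
        (((hgn.add (integrable_const _)).const_mul 3).const_mul _)
    · show ‖(m - β • (g z + ε • m)) - (y - β • (G.mapping y + ε • y))‖ ^ 2 ≤ _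
      rw [norm_sub_smul_add_sub_sq]
      gcongr
      exact hsq z
  have heval : ∫ z, (‖w‖ ^ 2 - 2 * β * (inner ℝ (g z) w - inner ℝ (G.mapping y) w + ε * ‖w‖ ^ 2)
        + β ^ 2 * (3 * (‖g z‖ ^ 2 + (D ^ 2 + S ^ 2 * ‖w‖ ^ 2)))) ∂ν
      = ‖w‖ ^ 2 - 2 * β * ((∫ z, inner ℝ (g z) w ∂ν) - inner ℝ (G.mapping y) w + ε * ‖w‖ ^ 2)
        + β ^ 2 * (3 * ((∫ z, ‖g z‖ ^ 2 ∂ν) + (D ^ 2 + S ^ 2 * ‖w‖ ^ 2))) := by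
    exact integral_const_sub_mul_add_mul hgw hgn _ _ _ _ _ _ _
  have hm : ‖m‖ ^ 2 ≤ 2 * ‖w‖ ^ 2 + 2 * Y ^ 2 := by
    have h1 : ‖m‖ ≤ ‖w‖ + Y := by
      have : ‖m‖ ≤ ‖m - y‖ + ‖y‖ := by simpa using norm_add_le (m - y) y
      linarith
    exact sq_norm_le_of_norm_le_add (norm_nonneg _) h1
  have hw2 : 2 * ‖w‖ ≤ 1 + ‖w‖ ^ 2 := by nlinarith [sq_nonneg (‖w‖ - 1)]
  -- Monotonicity discards the exact part, the regularization gives the contraction, and the bias,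
  -- linear in `‖w‖`, is absorbed by `2‖w‖ ≤ 1 + ‖w‖²`.
  have hlin : -(2 * β * ((∫ z, inner ℝ (g z) w ∂ν) - inner ℝ (G.mapping y) w + ε * ‖w‖ ^ 2))
      ≤ - (2 * (β * ε) * ‖w‖ ^ 2) + C₁ * (β * s) * (1 + ‖w‖ ^ 2) := by
    have h1 : -(C₁ * s * ‖w‖) ≤ (∫ z, inner ℝ (g z) w ∂ν) - inner ℝ (G.mapping y) w := by
      linarith
    have h2 : 2 * β * (-(C₁ * s * ‖w‖))
        ≤ 2 * β * ((∫ z, inner ℝ (g z) w ∂ν) - inner ℝ (G.mapping y) w) := by gcongr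
    have h3 : C₁ * (β * s) * (2 * ‖w‖) ≤ C₁ * (β * s) * (1 + ‖w‖ ^ 2) := by gcongr
    linarith
  have hquad : β ^ 2 * (3 * ((∫ z, ‖g z‖ ^ 2 ∂ν) + (D ^ 2 + S ^ 2 * ‖w‖ ^ 2)))
      ≤ 3 * (S ^ 2 * C₂ * (1 + 2 * Y ^ 2 + 2) + S ^ 4 * D ^ 2 + S ^ 6) * γ ^ 2
        * (1 + ‖w‖ ^ 2) := by
    -- Here `β ^ 2 / s ^ 2 = γ ^ 2 * s ^ 2`: the variance blow-up is paid for, and only `∑ γ²` must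
    -- be finite.
    have h1 : β ^ 2 * (∫ z, ‖g z‖ ^ 2 ∂ν)
        ≤ γ ^ 2 * (S ^ 2 * (C₂ * (1 + 2 * Y ^ 2 + 2) * (1 + ‖w‖ ^ 2))) := by
      calc β ^ 2 * (∫ z, ‖g z‖ ^ 2 ∂ν) ≤ β ^ 2 * (C₂ * (1 + ‖m‖ ^ 2) / s ^ 2) := by gcongr
        _ = γ ^ 2 * (s ^ 2 * (C₂ * (1 + ‖m‖ ^ 2))) := by rw [hβ]; field_simp
        _ ≤ γ ^ 2 * (S ^ 2 * (C₂ * ((1 + 2 * Y ^ 2 + 2) * (1 + ‖w‖ ^ 2)))) := by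
            gcongr
            have : 0 ≤ 2 * Y ^ 2 * ‖w‖ ^ 2 := by positivity
            nlinarith [sq_nonneg ‖w‖]
        _ = _ := by ring
    have h2 : β ^ 2 * (D ^ 2 + S ^ 2 * ‖w‖ ^ 2)
        ≤ γ ^ 2 * ((S ^ 4 * D ^ 2 + S ^ 6) * (1 + ‖w‖ ^ 2)) := by
      calc β ^ 2 * (D ^ 2 + S ^ 2 * ‖w‖ ^ 2)
          = γ ^ 2 * (s ^ 4 * (D ^ 2 + S ^ 2 * ‖w‖ ^ 2)) := by rw [hβ]; ring
        _ ≤ γ ^ 2 * (S ^ 4 * (D ^ 2 + S ^ 2 * ‖w‖ ^ 2)) := by gcongr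
        _ ≤ γ ^ 2 * ((S ^ 4 * D ^ 2 + S ^ 6) * (1 + ‖w‖ ^ 2)) := by
            gcongr γ ^ 2 * ?_
            have h4 : 0 ≤ S ^ 4 * D ^ 2 * ‖w‖ ^ 2 := by positivity
            have h5 : 0 ≤ S ^ 6 := by positivity
            linarith
    linarith
  refine hup.trans ?_
  rw [heval, hC]
  have h6 : 0 ≤ C₁ * γ ^ 2 * (1 + ‖w‖ ^ 2) := by positivity
  have h7 : 0 ≤ 3 * (S ^ 2 * C₂ * (1 + 2 * Y ^ 2 + 2) + S ^ 4 * D ^ 2 + S ^ 6) * (β * s)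
    * (1 + ‖w‖ ^ 2) := by positivity
  linarith

end PayoffLearning

/-! ### Almost supermartingales. -/

section AlmostSupermartingale

variable {Ω : Type*} [mΩ : MeasurableSpace Ω] {P : Measure Ω}

theorem ae_summable_of_summable_integral {f : ℕ → Ω → ℝ} (hInt : ∀ n, Integrable (f n) P)
    (hnn : ∀ n ω, 0 ≤ f n ω) (hs : Summable fun n => ∫ ω, f n ω ∂P) :
    ∀ᵐ ω ∂P, Summable fun n => f n ω := by
  have h1 : ∫⁻ ω, ∑' n, ENNReal.ofReal (f n ω) ∂P ≠ ⊤ := by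
    rw [lintegral_tsum fun n => (hInt n).aemeasurable.ennreal_ofReal]
    simp_rw [← ofReal_integral_eq_lintegral_ofReal (hInt _) (ae_of_all _ (hnn _))]
    exact hs.tsum_ofReal_ne_top
  filter_upwards [ae_lt_top' (AEMeasurable.tsum
    fun n => (hInt n).aemeasurable.ennreal_ofReal) h1] with ω hω
  refine (ENNReal.summable_toReal hω.ne).congr fun n => ?_
  exact ENNReal.toReal_ofReal (hnn n ω)

/-- A Robbins–Siegmund lemma with deterministic coefficients. -/
theorem ae_tendsto_zero_of_setIntegral_le [IsProbabilityMeasure P] {ℱ : Filtration ℕ mΩ}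
    {V : ℕ → Ω → ℝ} (hadp : StronglyAdapted ℱ V) (hInt : ∀ n, Integrable (V n) P)
    (hnn : ∀ n ω, 0 ≤ V n ω) {α p q : ℕ → ℝ} (hα : ∀ n, 0 ≤ α n) (hp : ∀ n, 0 ≤ p n)
    (hq : ∀ n, 0 ≤ q n) (hps : Summable p) (hqs : Summable q) (hαs : ¬ Summable α)
    (hstep : ∀ n, ∀ F : Set Ω, MeasurableSet[ℱ n] F →
      ∫ ω in F, V (n + 1) ω ∂P ≤ ∫ ω in F, ((1 - α n + p n) * V n ω + q n) ∂P) :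
    ∀ᵐ ω ∂P, Tendsto (fun n => V n ω) atTop (𝓝 0) := by
  -- The discount `c n` cancels the growth factors `1 + p k`, since `1 + p ≤ exp p`, and `R n`
  -- removes the accumulated `q k`. Thus `U` is a supermartingale whose decrease still dominates `c'
  -- * (α n * V n)`.
  set c : ℕ → ℝ := fun n => Real.exp (-∑ k ∈ Finset.range n, p k) with hc
  set c' : ℝ := Real.exp (-∑' k, p k) with hc'
  set R : ℕ → ℝ := fun n => ∑ k ∈ Finset.range n, q k with hR
  set U : ℕ → Ω → ℝ := fun n ω => c n * V n ω - R n with hU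
  have hc'0 : 0 < c' := Real.exp_pos _
  have hc0 : ∀ n, 0 < c n := fun n => Real.exp_pos _
  have hc1 : ∀ n, c n ≤ 1 := fun n =>
    Real.exp_le_one_iff.2 (neg_nonpos.2 (Finset.sum_nonneg fun k _ => hp k))
  have hcc' : ∀ n, c' ≤ c n := fun n =>
    Real.exp_le_exp.2 (neg_le_neg (hps.sum_le_tsum _ fun k _ => hp k))
  have hclim : Tendsto c atTop (𝓝 c') :=
    (Real.continuous_exp.tendsto _).comp hps.hasSum.tendsto_sum_nat.neg
  have hRlim : Tendsto R atTop (𝓝 (∑' k, q k)) := hqs.hasSum.tendsto_sum_nat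
  have hRle : ∀ n, R n ≤ ∑' k, q k := fun n => hqs.sum_le_tsum _ fun k _ => hq k
  have hR0 : ∀ n, 0 ≤ R n := fun n => Finset.sum_nonneg fun k _ => hq k
  have hcsucc : ∀ n, c (n + 1) * (1 + p n) ≤ c n := by
    intro n
    have h1 : c (n + 1) * Real.exp (p n) = c n := by
      simp only [hc, ← Real.exp_add, Finset.sum_range_succ]; congr 1; ring
    rw [← h1]
    gcongr
    linarith [Real.add_one_le_exp (p n)]
  have hUint : ∀ n, Integrable (U n) P := fun n =>
    ((hInt n).const_mul _).sub (integrable_const _)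
  have hkey : ∀ n, ∀ F : Set Ω, MeasurableSet[ℱ n] F →
      ∫ ω in F, U (n + 1) ω ∂P ≤ ∫ ω in F, (U n ω - c' * (α n * V n ω)) ∂P := by
    intro n F hF
    have hVF := (hInt n).integrableOn (s := F)
    have hVF1 := (hInt (n + 1)).integrableOn (s := F)
    have hA : IntegrableOn (fun ω => (1 - α n + p n) * V n ω + q n) F P :=
      (hVF.const_mul _).add (integrable_const _)
    calc ∫ ω in F, U (n + 1) ω ∂P
        = c (n + 1) * (∫ ω in F, V (n + 1) ω ∂P) - ∫ ω in F, R (n + 1) ∂P := by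
          rw [← integral_const_mul, ← integral_sub (hVF1.const_mul _) (integrable_const _)]
      _ ≤ c (n + 1) * (∫ ω in F, ((1 - α n + p n) * V n ω + q n) ∂P)
          - ∫ ω in F, R (n + 1) ∂P := by
          exact sub_le_sub_right (mul_le_mul_of_nonneg_left (hstep n F hF) (hc0 _).le) _
      _ = ∫ ω in F, (c (n + 1) * ((1 - α n + p n) * V n ω + q n) - R (n + 1)) ∂P := by
          rw [← integral_const_mul, ← integral_sub (hA.const_mul _) (integrable_const _)]
      _ ≤ _ := by
          refine integral_mono ((hA.const_mul _).sub (integrable_const _))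
            ((hUint n).integrableOn.sub ((hVF.const_mul _).const_mul _)) fun ω => ?_
          simp only [hU, hR, Finset.sum_range_succ]
          have h1 : c (n + 1) * (1 + p n) * V n ω ≤ c n * V n ω := by
            gcongr
            · exact hnn n ω
            · exact hcsucc n
          have h2 : c (n + 1) * q n ≤ 1 * q n := by
            gcongr
            · exact hq n
            · exact hc1 _
          have h3 : c' * (α n * V n ω) ≤ c (n + 1) * (α n * V n ω) := by
            gcongr
            · exact mul_nonneg (hα n) (hnn n ω)
            · exact hcc' _
          linarith
  have hUsuper : Supermartingale U ℱ P := by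
    refine supermartingale_of_setIntegral_succ_le
      (fun n => ((hadp n).const_mul _).sub stronglyMeasurable_const) hUint fun n F hF => ?_
    refine (hkey n F hF).trans (integral_mono
      ((hUint n).integrableOn.sub (((hInt n).integrableOn.const_mul _).const_mul _))
      (hUint n).integrableOn fun ω => ?_)
    have := mul_nonneg hc'0.le (mul_nonneg (hα n) (hnn n ω))
    simp only
    linarith
  have hdesc : ∀ n, (∫ ω, U (n + 1) ω ∂P) + c' * (∫ ω, α n * V n ω ∂P) ≤ ∫ ω, U n ω ∂P := by
    intro n
    have h := hkey n Set.univ MeasurableSet.univ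
    rw [setIntegral_univ, setIntegral_univ, integral_sub (hUint n)
      (((hInt n).const_mul _).const_mul _), integral_const_mul] at h
    linarith
  have hUlow : ∀ n, -(∑' k, q k) ≤ ∫ ω, U n ω ∂P := by
    intro n
    have h1 : ∫ _ω, -(∑' k, q k) ∂P ≤ ∫ ω, U n ω ∂P := by
      refine integral_mono (integrable_const _) (hUint n) fun ω => ?_
      have := mul_nonneg (hc0 n).le (hnn n ω)
      simp only [hU]
      linarith [hRle n]
    simpa using h1
  have hαV0 : ∀ n, 0 ≤ ∫ ω, α n * V n ω ∂P := fun n =>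
    integral_nonneg fun ω => mul_nonneg (hα n) (hnn n ω)
  have htel : ∀ n, (∫ ω, U n ω ∂P) + c' * ∑ k ∈ Finset.range n, (∫ ω, α k * V k ω ∂P)
      ≤ ∫ ω, U 0 ω ∂P := by
    intro n
    induction n with
    | zero => simp
    | succ n ih =>
      rw [Finset.sum_range_succ, mul_add]
      linarith [hdesc n]
  -- `U` is bounded below by `-∑ q`, so its total expected decrease is finite.
  have hsumαV : Summable fun n => ∫ ω, α n * V n ω ∂P := by
    refine summable_of_sum_range_le (c := ((∫ ω, U 0 ω ∂P) + ∑' k, q k) / c') hαV0 fun n => ?_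
    rw [le_div_iff₀ hc'0]
    linarith [htel n, hUlow n]
  have hUbdd : ∀ n, eLpNorm (U n) 1 P
      ≤ (((∫ ω, U 0 ω ∂P) + 2 * ∑' k, q k).toNNReal : ENNReal) := by
    intro n
    rw [eLpNorm_one_eq_lintegral_enorm, ← ofReal_integral_norm_eq_lintegral_enorm (hUint n)]
    refine ENNReal.ofReal_le_ofReal ?_
    have h1 : ∫ ω, ‖U n ω‖ ∂P ≤ ∫ ω, (U n ω + 2 * ∑' k, q k) ∂P := by
      refine integral_mono (hUint n).norm ((hUint n).add (integrable_const _)) fun ω => ?_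
      have h2 := mul_nonneg (hc0 n).le (hnn n ω)
      have h3 := hRle n
      have h4 := hR0 n
      simp only [hU, Real.norm_eq_abs]
      exact abs_le.2 ⟨by linarith, by linarith⟩
    rw [integral_add (hUint n) (integrable_const _)] at h1
    have h5 := htel n
    have h6 := mul_nonneg hc'0.le (Finset.sum_nonneg fun k (_ : k ∈ Finset.range n) => hαV0 k)
    simp only [integral_const, probReal_univ, one_smul] at h1
    linarith
  have hconv := hUsuper.neg.exists_ae_tendsto_of_bdd
    (R := ((∫ ω, U 0 ω ∂P) + 2 * ∑' k, q k).toNNReal)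
    (fun n => by rw [Pi.neg_apply, eLpNorm_neg]; exact hUbdd n)
  filter_upwards [hconv, ae_summable_of_summable_integral
    (fun n => (hInt n).const_mul (α n)) (fun n ω => mul_nonneg (hα n) (hnn n ω)) hsumαV]
    with ω ⟨l, hl⟩ hsum
  have hVlim : Tendsto (fun n => V n ω) atTop (𝓝 ((-l + ∑' k, q k) / c')) := by
    have h1 := ((hl.neg.add hRlim).div hclim hc'0.ne')
    refine h1.congr fun n => ?_
    have := (hc0 n).ne'
    simp only [hU, Pi.neg_apply, Pi.div_apply]
    field_simp
    ring
  set v := (-l + ∑' k, q k) / c'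
  have hv0 : 0 ≤ v := ge_of_tendsto' hVlim fun n => hnn n ω
  rcases hv0.eq_or_lt with h0 | h0
  · rwa [← h0] at hVlim
  -- A positive limit of `V` would make `α n` eventually at most `2 / v` times the summable `α n * V
  -- n`.
  · exfalso
    apply hαs
    refine Summable.of_norm_bounded_eventually_nat (g := fun n => 2 / v * (α n * V n ω))
      (hsum.mul_left _) ?_
    filter_upwards [hVlim.eventually (lt_mem_nhds (half_lt_self h0))] with n hn
    rw [Real.norm_of_nonneg (hα n)]
    have h3 : α n * (v / 2) ≤ α n * V n ω := by
      gcongr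
      exact hα n
    rw [div_mul_eq_mul_div, le_div_iff₀ h0]
    linarith

end AlmostSupermartingale

/-! ### The law of a play given the past. -/

namespace PayoffLearning

variable {N d : ℕ} {Ω : Type*} [mΩ : MeasurableSpace Ω] {P : Measure Ω}
  {ℱ : Filtration ℕ mΩ} {G : Game N d} {γ σ ε : ℕ → ℝ} {m₀ : Joint N d} {μ x : ℕ → Ω → Joint N d}

theorem IsRun.measurable_mean (h : IsRun P ℱ G γ σ ε m₀ μ x) (t : ℕ) : Measurable (μ t) :=
  (h.mean_meas t).mono (ℱ.le t) le_rfl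

theorem IsRun.measurable_play (h : IsRun P ℱ G γ σ ε m₀ μ x) (t : ℕ) : Measurable (x t) :=
  (h.play_meas t).mono (ℱ.le (t + 1)) le_rfl

theorem playLaw_apply (m : Joint N d) (s : ℝ) {B : Set (Joint N d)} (hB : MeasurableSet B) :
    playLaw m s B = stdGaussian (Joint N d) {z | m + s • z ∈ B} := by
  rw [playLaw_eq, Measure.map_apply (by fun_prop) hB]; rfl

/-- The joint law of the mean and the action on an event of the past. -/
theorem IsRun.map_restrict_eq [IsProbabilityMeasure P] (h : IsRun P ℱ G γ σ ε m₀ μ x) (t : ℕ)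
    {F : Set Ω} (hF : MeasurableSet[ℱ t] F) :
    (P.restrict F).map (fun ω => (μ t ω, x t ω)) =
      (((P.restrict F).map (μ t)).prod (stdGaussian (Joint N d))).map
        (fun p => (p.1, p.1 + σ t • p.2)) := by
  have hμ := h.measurable_mean t
  have hx := h.measurable_play t
  refine Measure.ext_prod fun {B₁ B₂} hB₁ hB₂ => ?_
  have hmeasK : Measurable fun m : Joint N d =>
      stdGaussian (Joint N d) {z | m + σ t • z ∈ B₂} := by
    have hm : MeasurableSet {p : Joint N d × Joint N d | p.1 + σ t • p.2 ∈ B₂} :=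
      (by fun_prop : Measurable fun p : Joint N d × Joint N d => p.1 + σ t • p.2) hB₂
    exact measurable_measure_prodMk_left hm
  -- The condition on the mean is again an event of the past, so on a rectangle only the conditional
  -- law of `x t` on `E` is needed.
  set E : Set Ω := F ∩ μ t ⁻¹' B₁ with hE
  have hEm : MeasurableSet[ℱ t] E := hF.inter (h.mean_meas t hB₁)
  have hlhs : (P.restrict F).map (fun ω => (μ t ω, x t ω)) (B₁ ×ˢ B₂) = P (E ∩ x t ⁻¹' B₂) := by
    rw [Measure.map_apply (hμ.prodMk hx) (hB₁.prod hB₂),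
      Measure.restrict_apply ((hμ.prodMk hx) (hB₁.prod hB₂))]
    congr 1
    ext ω
    simp [hE, and_comm, and_assoc]
  have hrhs : (((P.restrict F).map (μ t)).prod (stdGaussian (Joint N d))).map
      (fun p => (p.1, p.1 + σ t • p.2)) (B₁ ×ˢ B₂)
      = ∫⁻ ω in E, playLaw (μ t ω) (σ t) B₂ ∂P := by
    have hT : Measurable fun p : Joint N d × Joint N d => (p.1, p.1 + σ t • p.2) := by fun_prop
    rw [Measure.map_apply hT (hB₁.prod hB₂), Measure.prod_apply (hT (hB₁.prod hB₂)),
      lintegral_map (measurable_measure_prodMk_left (hT (hB₁.prod hB₂))) hμ, hE, Set.inter_comm,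
      ← Measure.restrict_restrict (hμ hB₁), ← lintegral_indicator (hμ hB₁)]
    refine lintegral_congr fun ω => ?_
    by_cases hω : μ t ω ∈ B₁
    · rw [Set.indicator_of_mem (by exact hω), playLaw_apply _ _ hB₂]
      congr 1
      ext z
      simp [hω]
    · rw [Set.indicator_of_notMem (by exact hω)]
      convert measure_empty (μ := stdGaussian (Joint N d))
      ext z
      simp [hω]
  rw [hlhs, hrhs]
  have hplay : ∀ m, IsProbabilityMeasure (playLaw m (σ t) : Measure (Joint N d)) := fun m => by
    rw [playLaw_eq]; exact Measure.isProbabilityMeasure_map (by fun_prop)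
  have hind : Integrable ((x t ⁻¹' B₂).indicator fun _ : Ω => (1 : ℝ)) P :=
    (integrable_const 1).indicator (hx hB₂)
  have hce := setIntegral_condExp (ℱ.le t) hind hEm
  rw [setIntegral_congr_ae ((ℱ.le t) _ hEm) ((h.play_law t B₂ hB₂).mono fun ω hω _ => hω),
    setIntegral_indicator (hx hB₂), setIntegral_const, smul_eq_mul, mul_one] at hce
  have hmeas' : Measurable fun ω => playLaw (μ t ω) (σ t) B₂ := by
    simp_rw [playLaw_apply _ _ hB₂]
    exact hmeasK.comp hμ
  have h1 : ∫⁻ ω in E, playLaw (μ t ω) (σ t) B₂ ∂P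
      = ENNReal.ofReal (∫ ω in E, (playLaw (μ t ω) (σ t)).real B₂ ∂P) := by
    rw [ofReal_integral_eq_lintegral_ofReal]
    · refine lintegral_congr fun ω => ?_
      rw [measureReal_def, ENNReal.ofReal_toReal (measure_ne_top _ _)]
    · refine Integrable.of_bound hmeas'.ennreal_toReal.aestronglyMeasurable 1
        (ae_of_all _ fun ω => ?_)
      rw [Real.norm_of_nonneg measureReal_nonneg]
      exact measureReal_le_one
    · exact ae_of_all _ fun ω => measureReal_nonneg
  rw [h1, hce, measureReal_def, ENNReal.ofReal_toReal (measure_ne_top _ _)]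

/-- Freezing: given the past, the mean is held fixed and the play is integrated out. Lower integrals
avoid any integrability assumption. -/
theorem IsRun.setLIntegral_eq [IsProbabilityMeasure P] (h : IsRun P ℱ G γ σ ε m₀ μ x) (t : ℕ)
    {F : Set Ω} (hF : MeasurableSet[ℱ t] F) {Ψ : Joint N d × Joint N d → ENNReal}
    (hΨ : Measurable Ψ) :
    ∫⁻ ω in F, Ψ (μ t ω, x t ω) ∂P =
      ∫⁻ ω in F, ∫⁻ z, Ψ (μ t ω, μ t ω + σ t • z) ∂(stdGaussian (Joint N d)) ∂P := by
  have hμ := h.measurable_mean t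
  have hx := h.measurable_play t
  have hT : Measurable fun p : Joint N d × Joint N d => (p.1, p.1 + σ t • p.2) := by fun_prop
  have hT2 : Measurable fun p : Joint N d × Joint N d => Ψ (p.1, p.1 + σ t • p.2) := hΨ.comp hT
  rw [← lintegral_map hΨ (hμ.prodMk hx), h.map_restrict_eq t hF, lintegral_map hΨ hT,
    lintegral_prod _ hT2.aemeasurable, lintegral_map hT2.lintegral_prod_right' hμ]

end PayoffLearning

/-! ### Convergence of the means and of the plays. -/

namespace PayoffLearning

variable {N d : ℕ} {Ω : Type*} [mΩ : MeasurableSpace Ω] {P : Measure Ω}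
  {ℱ : Filtration ℕ mΩ} {G : Game N d} {γ σ ε : ℕ → ℝ} {m₀ : Joint N d} {μ x : ℕ → Ω → Joint N d}

theorem Game.IsConvex.convex_jointSet (hG : G.IsConvex) : Convex ℝ G.jointSet :=
  fun _ hu _ hv _ _ ha hb hab i => hG.convex_set i (hu i) (hv i) ha hb hab

theorem Game.IsConvex.isClosed_jointSet (hG : G.IsConvex) : IsClosed G.jointSet := by
  have : G.jointSet = ⋂ i, (fun a : Joint N d => a i) ⁻¹' G.A i := by
    ext a; simp [Game.jointSet]
  rw [this]
  exact isClosed_iInter fun i => (hG.closed_set i).preimage (by fun_prop)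

theorem IsRun.next_mem (h : IsRun P ℱ G γ σ ε m₀ μ x) (t : ℕ) (ω : Ω) :
    μ (t + 1) ω ∈ G.jointSet := fun i => (h.update t ω i).1

/-- A regularized solution satisfies the angle condition for its own exact step, and the players'
separate projections add up to the angle condition on the product set. -/
theorem IsRun.norm_next_sub_le (h : IsRun P ℱ G γ σ ε m₀ μ x) (hG : G.IsConvex) (t : ℕ) (ω : Ω)
    {y : Joint N d} (hyA : y ∈ G.jointSet)
    (hy : ∀ z ∈ G.jointSet, 0 ≤ inner ℝ (G.mapping y + ε t • y) (z - y))
    (hβ : 0 ≤ γ t * σ t ^ 2) :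
    ‖μ (t + 1) ω - y‖ ≤
      ‖(μ t ω - (γ t * σ t ^ 2) • (G.estimate (σ t) (μ t ω) (x t ω) + ε t • μ t ω))
        - (y - (γ t * σ t ^ 2) • (G.mapping y + ε t • y))‖ := by
  refine norm_sub_le_of_inner_sub_le_zero ?_ ?_
  · rw [PiLp.inner_apply]
    refine Finset.sum_nonpos fun i _ => ?_
    obtain ⟨h1, h2⟩ := h.update t ω i
    exact inner_sub_le_zero_of_forall_norm_sub_le (hG.convex_set i) h1 h2 (hyA i)
  · rw [sub_sub_cancel_left, inner_neg_left, real_inner_smul_left]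
    have := mul_nonneg hβ (hy _ (h.next_mem t ω))
    linarith

theorem IsRun.setLIntegral_next_le [IsProbabilityMeasure P] (h : IsRun P ℱ G γ σ ε m₀ μ x)
    (hG : G.IsConvex) (hgrowth : G.LinearGrowth) (t : ℕ) {y : Joint N d} (hyA : y ∈ G.jointSet)
    (hy : ∀ z ∈ G.jointSet, 0 ≤ inner ℝ (G.mapping y + ε t • y) (z - y))
    (hγ : 0 < γ t) (hσ : 0 < σ t) {F : Set Ω} (hF : MeasurableSet[ℱ t] F) :
    ∫⁻ ω in F, ENNReal.ofReal (‖μ (t + 1) ω - y‖ ^ 2) ∂P ≤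
      ∫⁻ ω in F, ENNReal.ofReal
        (∫ z, ‖(μ t ω - (γ t * σ t ^ 2) • (G.estimate (σ t) (μ t ω) (μ t ω + σ t • z)
          + ε t • μ t ω)) - (y - (γ t * σ t ^ 2) • (G.mapping y + ε t • y))‖ ^ 2
          ∂(stdGaussian (Joint N d))) ∂P := by
  have hJc : ∀ i, Continuous (G.J i) := fun i => (hG.contDiff_cost i).continuous
  obtain ⟨B, hB, hJ⟩ := hgrowth.exists_bound hJc
  set Ψ : Joint N d × Joint N d → ENNReal := fun p => ENNReal.ofReal
    (‖(p.1 - (γ t * σ t ^ 2) • (G.estimate (σ t) p.1 p.2 + ε t • p.1))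
      - (y - (γ t * σ t ^ 2) • (G.mapping y + ε t • y))‖ ^ 2) with hΨ
  have hΨm : Measurable Ψ := by
    have h1 := Game.continuous_estimate hJc (σ t)
    exact (Continuous.measurable (by fun_prop)).ennreal_ofReal
  calc ∫⁻ ω in F, ENNReal.ofReal (‖μ (t + 1) ω - y‖ ^ 2) ∂P
      ≤ ∫⁻ ω in F, Ψ (μ t ω, x t ω) ∂P := by
        refine lintegral_mono fun ω => ENNReal.ofReal_le_ofReal ?_
        exact pow_le_pow_left₀ (norm_nonneg _)
          (h.norm_next_sub_le hG t ω hyA hy (by positivity)) 2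
    _ = _ := by
        rw [h.setLIntegral_eq t hF hΨm]
        refine lintegral_congr fun ω => ?_
        rw [ofReal_integral_eq_lintegral_ofReal
          (Game.integrable_step_sq hJc hB hJ hσ _ _ _ _) (ae_of_all _ fun z => by positivity)]

theorem IsRun.measurable_norm_sub_sq (h : IsRun P ℱ G γ σ ε m₀ μ x) (t : ℕ) (y : Joint N d) :
    StronglyMeasurable[ℱ t] fun ω => ‖μ t ω - y‖ ^ 2 := by
  have h1 : Measurable fun m : Joint N d => ‖m - y‖ ^ 2 := by fun_prop
  exact (h1.comp (h.mean_meas t)).stronglyMeasurable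

theorem integrable_norm_sub_sq_of_integrable [IsProbabilityMeasure P] {X : Ω → Joint N d}
    (hX : Measurable X) {y : Joint N d} (h : Integrable (fun ω => ‖X ω - y‖ ^ 2) P)
    (y' : Joint N d) : Integrable (fun ω => ‖X ω - y'‖ ^ 2) P := by
  have h1 : MemLp (fun ω => X ω - y) 2 P :=
    (memLp_two_iff_integrable_sq_norm (hX.sub_const y).aestronglyMeasurable).2 h
  have h2 : MemLp (fun ω => X ω - y') 2 P := by
    convert h1.add (memLp_const (y - y')) using 1
    ext1 ω; simp
  exact (memLp_two_iff_integrable_sq_norm (hX.sub_const y').aestronglyMeasurable).1 h2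

/-- Young's inequality with a free weight; taking `r` to be `βε` spends half of the contraction on
moving the centre. -/
theorem sq_norm_sub_le_mul_add {E : Type*} [NormedAddCommGroup E] (m y y' : E) {r : ℝ}
    (hr : 0 < r) :
    ‖m - y‖ ^ 2 ≤ (1 + r) * ‖m - y'‖ ^ 2 + (1 + 1 / r) * ‖y' - y‖ ^ 2 := by
  have h1 : ‖m - y‖ ≤ ‖m - y'‖ + ‖y' - y‖ := norm_sub_le_norm_sub_add_norm_sub _ _ _
  refine (pow_le_pow_left₀ (norm_nonneg _) h1 2).trans ?_
  have h2 : 0 ≤ (r * ‖m - y'‖ - ‖y' - y‖) ^ 2 / r := by positivity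
  have h3 : (r * ‖m - y'‖ - ‖y' - y‖) ^ 2 / r
      = r * ‖m - y'‖ ^ 2 - 2 * (‖m - y'‖ * ‖y' - y‖) + 1 / r * ‖y' - y‖ ^ 2 := by
    field_simp
    ring
  nlinarith

theorem StepSizes.gamma_pos {a b c : ℝ} (h : StepSizes a b c γ σ ε) (t : ℕ) : 0 < γ t := by
  rcases t with _ | t
  · exact h.gamma_zero
  · rw [h.gamma_eq _ (by omega)]; positivity

theorem StepSizes.sigma_pos {a b c : ℝ} (h : StepSizes a b c γ σ ε) (t : ℕ) : 0 < σ t := by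
  rcases t with _ | t
  · exact h.sigma_zero
  · rw [h.sigma_eq _ (by omega)]; positivity

theorem StepSizes.eps_pos {a b c : ℝ} (h : StepSizes a b c γ σ ε) (t : ℕ) : 0 < ε t := by
  rcases t with _ | t
  · exact h.eps_zero
  · rw [h.eps_eq _ (by omega)]; positivity

/-- The shift skips the arbitrary value `ε 0`. -/
theorem StepSizes.strictAnti_eps {a b c : ℝ} (h : StepSizes a b c γ σ ε) :
    StrictAnti fun t => ε (t + 1) := by
  refine strictAnti_nat_of_succ_lt fun t => ?_
  rw [h.eps_eq _ (by omega), h.eps_eq _ (by omega)]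
  have hc := h.c_pos
  gcongr
  omega

theorem StepSizes.tendsto_alpha {a b c : ℝ} (h : StepSizes a b c γ σ ε) :
    Tendsto (fun t => γ t * σ t ^ 2 * ε t) atTop (𝓝 0) := by
  have hγ : Tendsto γ atTop (𝓝 0) := by
    have h1 := h.gamma_sq_sum.tendsto_atTop_zero.sqrt
    simp only [Real.sqrt_zero] at h1
    exact h1.congr fun t => Real.sqrt_sq (h.gamma_pos t).le
  simpa using (hγ.mul (h.sigma_lim.pow 2)).mul h.eps_lim

/-- Elementary recursion for the distance to the moving regularized solution. -/
theorem regularized_step_le {w V α κ K δ : ℝ} (hα : 0 < α) (hα' : α ≤ 1 / 2) (hκ : 0 ≤ κ)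
    (hκK : κ ≤ K) (hV : 0 ≤ V) (hδ : 0 ≤ δ) (hw : w ≤ (1 + α) * V + (1 + 1 / α) * δ) :
    (1 - 2 * α) * w + κ * (1 + w)
      ≤ (1 - α + 2 * κ) * V + ((1 + K) * ((1 + 1 / α) * δ) + κ) := by
  have h0 : 0 ≤ 1 - 2 * α + κ := by linarith
  have hD : 0 ≤ (1 + 1 / α) * δ := by positivity
  have h1 := mul_le_mul_of_nonneg_left hw h0
  have h2 : (1 - 2 * α + κ) * ((1 + 1 / α) * δ) ≤ (1 + K) * ((1 + 1 / α) * δ) := by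
    gcongr
    linarith
  have h3 : (1 - 2 * α + κ) * ((1 + α) * V) ≤ (1 - α + 2 * κ) * V := by
    rw [← mul_assoc]
    gcongr
    nlinarith
  linarith

/-- A filtration read from time `k` on. -/
def shiftFiltration (ℱ : Filtration ℕ mΩ) (k : ℕ) : Filtration ℕ mΩ where
  seq n := ℱ (n + k)
  mono' _ _ hij := ℱ.mono (Nat.add_le_add_right hij k)
  le' n := ℱ.le (n + k)

theorem IsRun.integrable_next [IsProbabilityMeasure P] (h : IsRun P ℱ G γ σ ε m₀ μ x)
    (hG : G.IsConvex) (hmono : IsMonotoneOver G.mapping G.jointSet) (hlip : G.LipschitzMapping)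
    (hgrowth : G.LinearGrowth) {a b c : ℝ} (hstep : StepSizes a b c γ σ ε)
    {y : ℕ → Joint N d} (hyA : ∀ t, y t ∈ G.jointSet)
    (hy : ∀ t, ∀ z ∈ G.jointSet, 0 ≤ inner ℝ (G.mapping (y t) + ε t • y t) (z - y t)) (t : ℕ)
    (v : Joint N d) : Integrable (fun ω => ‖μ (t + 1) ω - v‖ ^ 2) P := by
  have hmeas : ∀ (t : ℕ) v, Measurable fun ω => ‖μ t ω - v‖ ^ 2 := fun t v =>
    ((h.measurable_norm_sub_sq t v).mono (ℱ.le t)).measurable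
  have key : ∀ t, (∫⁻ ω, ENNReal.ofReal (‖μ (t + 1) ω - y t‖ ^ 2) ∂P < ⊤) →
      ∀ v, Integrable (fun ω => ‖μ (t + 1) ω - v‖ ^ 2) P := by
    intro t ht v
    refine integrable_norm_sub_sq_of_integrable (h.measurable_mean _) (y := y t) ?_ v
    refine ⟨(hmeas _ _).aestronglyMeasurable, ?_⟩
    rw [hasFiniteIntegral_iff_ofReal (ae_of_all _ fun ω => by positivity)]
    exact ht
  induction t generalizing v with
  | zero =>
    refine key 0 ?_ v
    have h1 := h.setLIntegral_next_le hG hgrowth 0 (hyA 0) (hy 0) (hstep.gamma_pos 0)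
      (hstep.sigma_pos 0) (F := Set.univ) MeasurableSet.univ
    rw [Measure.restrict_univ] at h1
    refine h1.trans_lt ?_
    -- `m₀` may lie outside the action sets, so the one-step estimate is not available; but the mean
    -- is deterministic, hence the integrand is constant.
    simp_rw [h.init]
    simp
  | succ t ih =>
    refine key (t + 1) ?_ v
    have h1 := h.setLIntegral_next_le hG hgrowth (t + 1) (hyA (t + 1)) (hy (t + 1))
      (hstep.gamma_pos _) (hstep.sigma_pos _) (F := Set.univ) MeasurableSet.univ
    rw [Measure.restrict_univ] at h1
    refine h1.trans_lt ?_
    obtain ⟨C, hC, hbound⟩ := Game.exists_integral_step_sq_le hG hmono hlip hgrowth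
      (S := max (σ (t + 1)) (ε (t + 1))) (norm_nonneg (y (t + 1)))
    refine (lintegral_mono fun ω => ENNReal.ofReal_le_ofReal (hbound _ _ _ (hstep.gamma_pos _)
      (hstep.sigma_pos _) (le_max_left _ _) (hstep.eps_pos _) (le_max_right _ _) _ (hyA _) le_rfl _
      (h.next_mem t ω))).trans_lt ?_
    have hInt := ((ih (y (t + 1))).const_mul
      (1 - 2 * (γ (t + 1) * σ (t + 1) ^ 2 * ε (t + 1)))).add
      (((integrable_const (1 : ℝ)).add (ih (y (t + 1)))).const_mul
        (C * (γ (t + 1) * σ (t + 1) ^ 2 * σ (t + 1) + γ (t + 1) ^ 2)))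
    exact hInt.lintegral_lt_top

/-- The means approach the trajectory of the regularized solutions. -/
theorem IsRun.ae_tendsto_norm_sub_regularized [IsProbabilityMeasure P]
    (h : IsRun P ℱ G γ σ ε m₀ μ x)
    (hG : G.IsConvex) (hmono : IsMonotoneOver G.mapping G.jointSet) (hlip : G.LipschitzMapping)
    (hgrowth : G.LinearGrowth) {a b c : ℝ} (hstep : StepSizes a b c γ σ ε)
    {y : ℕ → Joint N d} (hyA : ∀ t, y t ∈ G.jointSet)
    (hy : ∀ t, ∀ z ∈ G.jointSet, 0 ≤ inner ℝ (G.mapping (y t) + ε t • y t) (z - y t))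
    {Y : ℝ} (hyY : ∀ t, ‖y t‖ ≤ Y) :
    ∀ᵐ ω ∂P, Tendsto (fun t => ‖μ (t + 1) ω - y t‖ ^ 2) atTop (𝓝 0) := by
  have hY0 : 0 ≤ Y := (norm_nonneg _).trans (hyY 0)
  obtain ⟨S₁, hS₁⟩ := hstep.sigma_lim.bddAbove_range
  obtain ⟨S₂, hS₂⟩ := hstep.eps_lim.bddAbove_range
  have hσS : ∀ t, σ t ≤ max S₁ S₂ := fun t => (hS₁ ⟨t, rfl⟩).trans (le_max_left _ _)
  have hεS : ∀ t, ε t ≤ max S₁ S₂ := fun t => (hS₂ ⟨t, rfl⟩).trans (le_max_right _ _)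
  obtain ⟨C, hC, hbound⟩ := Game.exists_integral_step_sq_le hG hmono hlip hgrowth
    (S := max S₁ S₂) hY0
  -- Beyond `T` one has `βε ≤ 1/2`, which keeps the recursion coefficients nonnegative.
  obtain ⟨T, hT⟩ := eventually_atTop.1
    (hstep.tendsto_alpha.eventually (ge_mem_nhds (by norm_num : (0 : ℝ) < 1 / 2)))
  set κ : ℕ → ℝ := fun t => C * (γ t * σ t ^ 2 * σ t + γ t ^ 2) with hκ
  have hγ := hstep.gamma_pos
  have hσ := hstep.sigma_pos
  have hε := hstep.eps_pos
  have hκ0 : ∀ t, 0 ≤ κ t := fun t => by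
    have := hγ t; have := hσ t; positivity
  have hκs : Summable κ := (hstep.beta_sigma_sum.add hstep.gamma_sq_sum).mul_left C
  have hκK : ∀ t, κ t ≤ ∑' k, κ k := fun t => hκs.le_tsum t fun k _ => hκ0 k
  set K : ℝ := ∑' k, κ k
  have hK0 : 0 ≤ K := tsum_nonneg hκ0
  set α : ℕ → ℝ := fun t => γ t * σ t ^ 2 * ε t with hα
  have hα0 : ∀ t, 0 < α t := fun t => by
    have := hγ t; have := hσ t; have := hε t; positivity
  set δ : ℕ → ℝ := fun t => Y ^ 2 * (|ε t - ε (t + 1)| ^ 2 / ε (t + 1) ^ 2) with hδ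
  have hδ0 : ∀ t, 0 ≤ δ t := fun t => by positivity
  have hdrift : ∀ t, ‖y t - y (t + 1)‖ ^ 2 ≤ δ t := by
    intro t
    have h1 := regularized_vi_norm_sub_le (hε (t + 1)) (hmono _ (hyA (t + 1)) _ (hyA t))
      (hy (t + 1) _ (hyA t)) (hy t _ (hyA (t + 1)))
    have h2 : ‖y t - y (t + 1)‖ ≤ |ε t - ε (t + 1)| / ε (t + 1) * Y := by
      refine h1.trans ?_
      rw [abs_sub_comm]
      have := hε (t + 1)
      gcongr
      exact hyY t
    refine (pow_le_pow_left₀ (norm_nonneg _) h2 2).trans (le_of_eq ?_)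
    simp only [hδ]
    ring
  have hαδs : Summable fun t => (1 + 1 / α (t + 1)) * δ t := by
    refine (hstep.drift_sum.mul_left (Y ^ 2)).congr fun t => ?_
    simp only [hα, hδ]
    ring
  have hshift : ∀ᵐ ω ∂P,
      Tendsto (fun n => ‖μ (n + (T + 1)) ω - y (n + T)‖ ^ 2) atTop (𝓝 0) := by
    -- The centre lags by one, since the update at time `t` contracts towards `y t`. Starting at `T
    -- + 1 ≥ 1` also ensures that the means lie in the action sets.
    refine ae_tendsto_zero_of_setIntegral_le (ℱ := shiftFiltration ℱ (T + 1))
      (α := fun n => α (n + (T + 1))) (p := fun n => 2 * κ (n + (T + 1)))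
      (q := fun n => (1 + K) * ((1 + 1 / α (n + T + 1)) * δ (n + T)) + κ (n + (T + 1)))
      (V := fun n ω => ‖μ (n + (T + 1)) ω - y (n + T)‖ ^ 2)
      (fun n => h.measurable_norm_sub_sq (n + (T + 1)) (y (n + T)))
      (fun n => h.integrable_next hG hmono hlip hgrowth hstep hyA hy (n + T) _)
      (fun n ω => by positivity) (fun n => (hα0 _).le)
      (fun n => mul_nonneg zero_le_two (hκ0 _)) (fun n => ?_)
      (((summable_nat_add_iff (T + 1)).2 hκs).mul_left 2)
      ((((summable_nat_add_iff T).2 hαδs).mul_left (1 + K)).add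
        ((summable_nat_add_iff (T + 1)).2 hκs))
      (fun hs => hstep.beta_eps_sum ((summable_nat_add_iff (T + 1)).1 hs)) ?_
    · have := hα0 (n + T + 1)
      have := hδ0 (n + T)
      have := hκ0 (n + (T + 1))
      positivity
    · intro n F hF
      set t : ℕ := n + T with ht
      change MeasurableSet[ℱ (t + 1)] F at hF
      change ∫ ω in F, ‖μ (n + 1 + (T + 1)) ω - y (n + 1 + T)‖ ^ 2 ∂P
        ≤ ∫ ω in F, ((1 - α (t + 1) + 2 * κ (t + 1)) * ‖μ (t + 1) ω - y t‖ ^ 2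
          + ((1 + K) * ((1 + 1 / α (t + 1)) * δ t) + κ (t + 1))) ∂P
      have e1 : n + 1 + (T + 1) = t + 1 + 1 := by omega
      have e2 : n + 1 + T = t + 1 := by omega
      rw [e1, e2]
      have hInt := h.integrable_next hG hmono hlip hgrowth hstep hyA hy
      have hpt : ∀ ω, (1 - 2 * (γ (t + 1) * σ (t + 1) ^ 2 * ε (t + 1)))
            * ‖μ (t + 1) ω - y (t + 1)‖ ^ 2
            + C * (γ (t + 1) * σ (t + 1) ^ 2 * σ (t + 1) + γ (t + 1) ^ 2)
              * (1 + ‖μ (t + 1) ω - y (t + 1)‖ ^ 2)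
          ≤ (1 - α (t + 1) + 2 * κ (t + 1)) * ‖μ (t + 1) ω - y t‖ ^ 2
            + ((1 + K) * ((1 + 1 / α (t + 1)) * δ t) + κ (t + 1)) := by
        intro ω
        refine regularized_step_le (hα0 (t + 1)) (hT (t + 1) (by omega)) (hκ0 _) (hκK _)
          (by positivity) (hδ0 t) ?_
        refine (sq_norm_sub_le_mul_add (μ (t + 1) ω) (y (t + 1)) (y t) (hα0 (t + 1))).trans ?_
        have := hα0 (t + 1)
        gcongr
        exact hdrift t
      set q : ℝ := (1 + K) * ((1 + 1 / α (t + 1)) * δ t) + κ (t + 1)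
      have hrhs : Integrable (fun ω => (1 - α (t + 1) + 2 * κ (t + 1)) * ‖μ (t + 1) ω - y t‖ ^ 2
          + q) (P.restrict F) :=
        (((hInt t (y t)).const_mul _).add (integrable_const _)).integrableOn
      have hq0 : 0 ≤ q := by
        have := hα0 (t + 1)
        have := hδ0 t
        have := hκ0 (t + 1)
        positivity
      have hrhs0 : ∀ ω, 0 ≤ (1 - α (t + 1) + 2 * κ (t + 1)) * ‖μ (t + 1) ω - y t‖ ^ 2 + q := by
        intro ω
        have h1 : α (t + 1) ≤ 1 / 2 := hT (t + 1) (by omega)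
        have h2 := hκ0 (t + 1)
        have : 0 ≤ 1 - α (t + 1) + 2 * κ (t + 1) := by linarith
        positivity
      -- The freezing estimate concerns lower integrals; both integrands are nonnegative, so it
      -- transfers.
      rw [integral_eq_lintegral_of_nonneg_ae (ae_of_all _ fun ω => by positivity)
          (hInt (t + 1) _).integrableOn.aestronglyMeasurable,
        integral_eq_lintegral_of_nonneg_ae (ae_of_all _ hrhs0) hrhs.aestronglyMeasurable]
      refine ENNReal.toReal_mono hrhs.lintegral_lt_top.ne ?_
      refine (h.setLIntegral_next_le hG hgrowth (t + 1) (hyA (t + 1)) (hy (t + 1))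
        (hγ _) (hσ _) hF).trans ?_
      refine lintegral_mono fun ω => ENNReal.ofReal_le_ofReal ?_
      exact (hbound _ _ _ (hγ _) (hσ _) (hσS _) (hε _) (hεS _) _ (hyA _) (hyY _) _
        (h.next_mem t ω)).trans (hpt ω)
  filter_upwards [hshift] with ω hω
  exact (tendsto_add_atTop_iff_nat (f := fun t => ‖μ (t + 1) ω - y t‖ ^ 2) T).1 hω

theorem IsRun.eLpNorm_play_sub_mean [IsProbabilityMeasure P] (h : IsRun P ℱ G γ σ ε m₀ μ x)
    (t : ℕ) : eLpNorm (fun ω => x t ω - μ t ω) 1 P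
      = ‖σ t‖ₑ * ∫⁻ z, ‖z‖ₑ ∂(stdGaussian (Joint N d)) := by
  have h1 := h.setLIntegral_eq t (F := Set.univ) MeasurableSet.univ
    (Ψ := fun p => ‖p.2 - p.1‖ₑ) (by fun_prop)
  rw [Measure.restrict_univ] at h1
  rw [eLpNorm_one_eq_lintegral_enorm, h1]
  simp_rw [add_sub_cancel_left, enorm_smul]
  rw [lintegral_const_mul _ (by fun_prop)]
  simp

/-- The deviation `x t - μ t` tends to zero in `L¹`, hence in measure, and is added to the almost
sure limit of the means. -/
theorem IsRun.tendstoInMeasure_play [IsProbabilityMeasure P] (h : IsRun P ℱ G γ σ ε m₀ μ x)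
    (hσ : Tendsto σ atTop (𝓝 0)) {a : Joint N d}
    (hμ : ∀ᵐ ω ∂P, Tendsto (fun t => μ t ω) atTop (𝓝 a)) :
    TendstoInMeasure P x atTop (fun _ => a) := by
  have h1 : TendstoInMeasure P (fun t ω => x t ω - μ t ω) atTop 0 := by
    refine tendstoInMeasure_of_tendsto_eLpNorm one_ne_zero
      (fun t => ((h.measurable_play t).sub (h.measurable_mean t)).aestronglyMeasurable)
      aestronglyMeasurable_zero ?_
    simp_rw [sub_zero, h.eLpNorm_play_sub_mean]
    have hfin : ∫⁻ z, ‖z‖ₑ ∂(stdGaussian (Joint N d)) ≠ ⊤ :=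
      (IsGaussian.integrable_id (μ := stdGaussian (Joint N d))).2.ne
    have h2 : Tendsto (fun t => ‖σ t‖ₑ) atTop (𝓝 0) := by simpa using hσ.enorm
    simpa using ENNReal.Tendsto.mul_const h2 (Or.inr hfin)
  have h2 : TendstoInMeasure P μ atTop (fun _ => a) :=
    tendstoInMeasure_of_tendsto_ae (fun t => (h.measurable_mean t).aestronglyMeasurable) hμ
  rw [tendstoInMeasure_iff_norm] at h1 h2 ⊢
  intro r hr
  have h3 := (h1 (r / 2) (half_pos hr)).add (h2 (r / 2) (half_pos hr))
  rw [add_zero] at h3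
  refine tendsto_of_tendsto_of_tendsto_of_le_of_le tendsto_const_nhds h3 (fun _ => zero_le)
    fun t => (measure_mono fun ω hω => ?_).trans (measure_union_le _ _)
  simp only [Set.mem_ofPred_eq, Set.mem_union, Pi.zero_apply, sub_zero] at hω ⊢
  by_contra hcon
  push Not at hcon
  have h4 : ‖x t ω - a‖ ≤ ‖x t ω - μ t ω‖ + ‖μ t ω - a‖ := norm_sub_le_norm_sub_add_norm_sub _ _ _
  linarith [hcon.1, hcon.2]

end PayoffLearning

/-! ### The main theorem. -/

theorem theorem2 {N d : ℕ} (G : PayoffLearning.Game N d)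
    (hconvex : G.IsConvex)
    (hmono : PayoffLearning.IsMonotoneOver G.mapping G.jointSet)
    (hsol : (PayoffLearning.viSol G.jointSet G.mapping).Nonempty)
    (hlip : G.LipschitzMapping)
    (hgrowth : G.LinearGrowth)
    {a b c : ℝ} {γ σ ε : ℕ → ℝ} (hstep : PayoffLearning.StepSizes a b c γ σ ε)
    {Ω : Type*} [mΩ : MeasurableSpace Ω] (P : Measure Ω) [IsProbabilityMeasure P]
    (ℱ : Filtration ℕ mΩ) (m₀ : PayoffLearning.Joint N d)
    (μ x : ℕ → Ω → PayoffLearning.Joint N d)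
    (hrun : PayoffLearning.IsRun P ℱ G γ σ ε m₀ μ x) :
    ∃ aStar : PayoffLearning.Joint N d,
      G.IsNash aStar ∧
      (∀ a', G.IsNash a' → ‖aStar‖ ≤ ‖a'‖) ∧
      (∀ᵐ ω ∂P, Tendsto (fun t => μ t ω) atTop (𝓝 aStar)) ∧
      TendstoInMeasure P x atTop (fun _ => aStar) := by
  obtain ⟨s, hsA, hs⟩ := hsol
  obtain ⟨L, hL, -, hLu⟩ := hlip.exists_bound
  have hcont : Continuous G.mapping :=
    (LipschitzWith.of_dist_le_mul (K := L.toNNReal) fun u v => by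
      rw [dist_eq_norm, dist_eq_norm, Real.coe_toNNReal _ hL]; exact hLu u v).continuous
  choose y hyA hy using fun t => exists_regularized_vi hconvex.convex_jointSet
    hconvex.isClosed_jointSet ⟨s, hsA⟩ hL (fun u _ v _ => hLu u v) hmono (hstep.eps_pos t)
  have hyY : ∀ t, ‖y t‖ ≤ ‖s‖ := by
    intro t
    have h := regularized_vi_norm_sq_sub le_rfl (hstep.eps_pos t) (hmono _ (hyA t) _ hsA)
      (hy t s hsA) (by simpa using hs (y t) (hyA t))
    have h2 : 0 ≤ ‖s - y t‖ ^ 2 := by positivity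
    exact le_of_sq_le_sq (by linarith) (norm_nonneg _)
  obtain ⟨aStar, haA, hasol, hylim, hmin⟩ := exists_tendsto_tikhonov hconvex.isClosed_jointSet
    hcont hmono hsA hs (fun t => hstep.eps_pos (t + 1)) hstep.strictAnti_eps
    ((tendsto_add_atTop_iff_nat 1).2 hstep.eps_lim) (fun t => hyA (t + 1)) (fun t => hy (t + 1))
  have hylim' : Tendsto y atTop (𝓝 aStar) := (tendsto_add_atTop_iff_nat 1).1 hylim
  have hμ : ∀ᵐ ω ∂P, Tendsto (fun t => μ t ω) atTop (𝓝 aStar) := by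
    filter_upwards [hrun.ae_tendsto_norm_sub_regularized hconvex hmono hlip hgrowth hstep hyA hy
      hyY] with ω hω
    have h1 : Tendsto (fun t => ‖μ (t + 1) ω - y t‖) atTop (𝓝 0) := by
      have := hω.sqrt
      simpa [Real.sqrt_sq (norm_nonneg _)] using this
    have h2 := (tendsto_zero_iff_norm_tendsto_zero.2 h1).add hylim'
    simp only [sub_add_cancel, zero_add] at h2
    exact (tendsto_add_atTop_iff_nat 1).1 h2
  refine ⟨aStar, (hconvex.isNash_iff _).2 ⟨haA, hasol⟩, fun a' ha' => ?_, hμ,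
    hrun.tendstoInMeasure_play hstep.sigma_lim hμ⟩
  obtain ⟨h1, h2⟩ := (hconvex.isNash_iff a').1 ha'
  exact hmin a' h1 h2
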